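/- Let $M>0$, $\alpha<0$, $\tau>0$, let $\mathbb T=\mathbb R/\mathbb Z$ with $d(x,y)=\min\{|x-y|,1-|x-y|\}$, and let $P_M(\mathbb T)$ be the set of densities $u\ge 0$ on $\mathbb T$ with $\int_{\mathbb T}u\,dx=M$; $u$ is point-symmetric if $u(x)=u(1-x)$ for a.e. $x$, and $P_M^{s}(\mathbb T)$ is the set of point-symmetric $u\in P_M(\mathbb T)$. Let $W[u,v]^2=\inf_\pi\int_{\mathbb T\times\mathbb T} d(x,y)^2\,d\pi(x,y)$, the infimum over all measures $\pi$ on $\mathbb T\times\mathbb T$ with marginals $u\,dx$ and $v\,dx$, and $S[u]=\frac1{\alpha(\alpha-1)}\int_{\mathbb T}u^\alpha\,dx\in[0,\infty]$ (with $0^\alpha=\infty$). Let $\mathcal G_M$ be the set of measurable $g:[0,M]\to(0,\infty)$ with $\int_0^M g\,d\omega=1$. Functions are identified if they agree almost everywhere. Call $u\in P_M(\mathbb T)$ and $g\in\mathcal G_M$ *related* if $$u(x_\omega)=\frac1{g(\omega)},\qquad x_\omega=\int_0^\omega g(\eta)\,d\eta,\qquad\text{for a.e. }\omega\in[0,M].$$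 For real $a_0,\dots,a_k$ with $\sum_{i=0}^k a_i=0$ and $a_k>0$ (as for every BDF-$k$ scheme), and for previous iterates $u^{n},\dots,u^{n+k-1}\in P_M^{s}(\mathbb T)$ related to $g^{n},\dots,g^{n+k-1}\in\mathcal G_M$, let $$\Phi(u)=-\frac1{2\tau}\sum_{i=0}^{k-1}a_iW[u^{n+i},u]^2+S[u],$$ $$\Psi(g)=-\frac1{2\tau}\int_0^M\!\!\int_0^M(M-\max\{\eta,\eta'\})\sum_{i=0}^{k-1}a_i\big(g(\eta)-g^{n+i}(\eta)\big)\big(g(\eta')-g^{n+i}(\eta')\big)\,d\eta\,d\eta'+\frac1{\alpha(\alpha-1)}\int_0^M g(\omega)^{1-\alpha}\,d\omega .$$ 1. Being related is a one-to-one correspondence between the a.e. positive $u\in P_M(\mathbb T)$ and all $g\in\mathcal G_M$. 2. If $u\in P^s_M(\mathbb T)$ and $g\in\mathcal G_M$ are related, then $\Phi(u)=\Psi(g)$, and $u$ minimizes $\Phi$ over $P_M^{s}(\mathbb T)$ if and only if $g$ minimizes $\Psi$ over $\mathcal G_M$. Every minimizer $u^{n+k}$ of $\Phi$ over $P_M^s(\mathbb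 T)$ is related to a minimizer $g^{n+k}$ of $\Psi$ over $\mathcal G_M$, and conversely. If at most one of $a_0,\dots,a_{k-1}$ is negative (as for BDF-1 and BDF-2), then the minimizers of $\Phi$ over $P_M(\mathbb T)$ and over $P_M^s(\mathbb T)$ are the same. 3. Consider the inductive scheme that starts from a point-symmetric $u^0$ related to $g^0$ and in which, for every $m\ge1$, $u^m$ minimizes over $P_M^s(\mathbb T)$ the functional $\Phi$ of a scheme of order $r_m$ with the iterates $u^{m-r_m},\dots,u^{m-1}$, where $1\le r_m\le m$, and $r_m=k$ for $m\ge k$ (so that the first $k-1$ steps use lower-order schemes). For every solution $(u^n)$ there is a solution $(g^n)$, starting from $g^0$, of the scheme that minimizes the corresponding functionals $\Psi$ over $\mathcal G_M$, with $u^n$ and $g^n$ related for all $n$; and conversely. If in every step at most one of the coefficients $a_0,\dots,a_{r_m-1}$ is negative, then the solutions $(u^n)$ are the same when $P_M^s(\mathbb T)$ is replaced by $P_M(\mathbb T)$. -/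

import Mathlib

open MeasureTheory

noncomputable section

namespace BDFWasserstein

/-- Transport plans: measures on `X × X` with first marginal `μ` and second marginal `ν`. -/
def transportPlans {X : Type*} [MeasurableSpace X] (μ ν : Measure X) : Set (Measure (X × X)) :=
  {π | π.map Prod.fst = μ ∧ π.map Prod.snd = ν}

/-- The `L²`-Wasserstein distance of two finite measures of the same total mass on a bounded metric
space: the square root of the infimum of the transport costs `∫ d(x,y)² dπ(x,y)`. -/
def wasserstein {X : Type*} [MeasurableSpace X] [PseudoEMetricSpace X] (μ ν : Measure X) : ℝ :=
  Real.sqrt (⨅ π ∈ transportPlans μ ν, ∫⁻ p, edist p.1 p.2 ^ 2 ∂π).toReal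

/-- The measure `u dx` on the torus `𝕋 = ℝ/ℤ`; `UnitAddCircle` carries the Lebesgue measure of
total mass one and the distance `min {|x - y|, 1 - |x - y|}`. -/
def toMeasure (u : UnitAddCircle → ℝ) : Measure UnitAddCircle :=
  volume.withDensity fun x => ENNReal.ofReal (u x)

/-- `W[u, v]` for two densities on the torus. -/
def W (u v : UnitAddCircle → ℝ) : ℝ := wasserstein (toMeasure u) (toMeasure v)

/-- `P_M(𝕋)`: the nonnegative densities of mass `M` on the torus. -/
def Densities (M : ℝ) : Set (UnitAddCircle → ℝ) :=
  {u | Measurable u ∧ (∀ x, 0 ≤ u x) ∧ Integrable u ∧ ∫ x, u x = M}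

/-- The point-symmetric densities, `u(x) = u(1 - x)` (almost everywhere, as usual for densities);
on `ℝ/ℤ` one has `1 - x = -x`. -/
def SymDensities (M : ℝ) : Set (UnitAddCircle → ℝ) :=
  {u | u ∈ Densities M ∧ ∀ᵐ x, u (-x) = u x}

/-- The entropy `S[u] = (α(α-1))⁻¹ ∫ u^α dx` for `α < 0`, with values in `[0,∞]`. Here `0 ^ α = ∞`,
so the entropy is infinite when `u` vanishes on a set of positive measure. -/
def entropy (α : ℝ) (u : UnitAddCircle → ℝ) : ENNReal :=
  ENNReal.ofReal (1 / (α * (α - 1))) * ∫⁻ x, ENNReal.ofReal (u x) ^ α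

/-- The functional `Φ(u) = -1/(2τ) ∑_{i<k} aᵢ W[vᵢ, u]² + S[u]` of one step with the previous
iterates `v₀, …, v_{k-1}`. -/
def Phi (α τ : ℝ) (k : ℕ) (a : ℕ → ℝ) (v : ℕ → UnitAddCircle → ℝ) (u : UnitAddCircle → ℝ) : EReal :=
  ((-(1 / (2 * τ)) * ∑ i ∈ Finset.range k, a i * W (v i) u ^ 2 : ℝ) : EReal)
    + (entropy α u : EReal)

/-- The measurable functions that are positive on `[0,M]` and satisfy `∫_0^M g = 1`. Only the values
on `[0,M]` matter. -/
def Slopes (M : ℝ) : Set (ℝ → ℝ) :=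
  {g | Measurable g ∧ (∀ ω ∈ Set.Icc 0 M, 0 < g ω) ∧
    IntervalIntegrable g volume 0 M ∧ ∫ ω in (0 : ℝ)..M, g ω = 1}

/-- The functional `Ψ(g)` of one step with the previous iterates `h₀, …, h_{k-1}`. -/
def Psi (M α τ : ℝ) (k : ℕ) (a : ℕ → ℝ) (h : ℕ → ℝ → ℝ) (g : ℝ → ℝ) : EReal :=
  ((-(1 / (2 * τ)) * ∫ η in (0 : ℝ)..M, ∫ η' in (0 : ℝ)..M,
      (M - max η η') * ∑ i ∈ Finset.range k, a i * ((g η - h i η) * (g η' - h i η')) : ℝ) : EReal)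
    + ((ENNReal.ofReal (1 / (α * (α - 1))) *
        ∫⁻ ω in Set.Icc 0 M, ENNReal.ofReal (g ω ^ (1 - α)) : ENNReal) : EReal)

/-- The relation `u(x_ω) = 1/g(ω)`, `x_ω = ∫_0^ω g`, for almost every `ω ∈ [0,M]`. -/
def Related (M : ℝ) (u : UnitAddCircle → ℝ) (g : ℝ → ℝ) : Prop :=
  ∀ᵐ ω ∂(volume.restrict (Set.Icc 0 M)),
    u ((∫ η in (0 : ℝ)..ω, g η : ℝ) : UnitAddCircle) = 1 / g ω

/-- `x ∈ argmin_C F`. -/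
def IsArgmin {X : Type*} (F : X → EReal) (C : Set X) (x : X) : Prop :=
  x ∈ C ∧ IsMinOn F C x

/-- `u⁰, u¹, …` solves the minimizing movement scheme over the class `C`, whose step producing `uᵐ`
has order `r m` and uses the coefficients `a (r m)` and the iterates `u^{m - r m}, …, u^{m-1}`. -/
def SolvesU (α τ : ℝ) (C : Set (UnitAddCircle → ℝ)) (r : ℕ → ℕ) (a : ℕ → ℕ → ℝ)
    (u : ℕ → UnitAddCircle → ℝ) : Prop :=
  ∀ m, 1 ≤ m → IsArgmin (Phi α τ (r m) (a (r m)) fun i => u (m - r m + i)) C (u m)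

/-- `g⁰, g¹, …` solves the corresponding scheme in Lagrangian coordinates. -/
def SolvesG (M α τ : ℝ) (r : ℕ → ℕ) (a : ℕ → ℕ → ℝ) (g : ℕ → ℝ → ℝ) : Prop :=
  ∀ m, 1 ≤ m → IsArgmin (Psi M α τ (r m) (a (r m)) fun i => g (m - r m + i)) (Slopes M) (g m)

/-- The coefficients `a₀, …, a_k` of a `k`-step scheme `∑ aᵢ x^{n+i} = -τ ∇φ(x^{n+k})` with
`∑ aᵢ = 0` and `a_k > 0`. Every BDF scheme is of this kind, with `a_k = 1 + 1/2 + ⋯ + 1/k`. -/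
def IsStepCoeff (k : ℕ) (a : ℕ → ℝ) : Prop :=
  ∑ i ∈ Finset.range (k + 1), a i = 0 ∧ 0 < a k

/-- Among `a₀, …, a_{k-1}` at most one is negative, as for BDF-1 (`-1`) and BDF-2 (`1/2, -2`). -/
def OneNegative (k : ℕ) (a : ℕ → ℝ) : Prop :=
  ∃ j, ∀ i < k, i ≠ j → 0 ≤ a i

end BDFWasserstein

end

/-! A positive density `u` of mass `M` on the circle is parametrized by the inverse `G` of its
distribution function, extended to the line by `G (ω + M) = G ω + 1`; then `G' = g = 1 / u ∘ G`. In
these coordinates being related means that `G` modulo one pushes Lebesgue measure on `(0,M]` to `u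
dx` (`related_iff_pushCircle`), and point symmetry of `u` means that `G` is odd (`symm_iff_odd`).

Two lifts `G`, `H` give the transport plan `ω ↦ (H ω, G ω)`, so `W² ≤ ∫ (G - H)²`. Equality holds if
the displacement of `T = G ∘ H⁻¹` has mean zero: then the Kantorovich potential with derivative `2
(s - T s)` is periodic, descends to the circle and certifies optimality (`le_infCost`). Odd lifts
have this property, so between symmetric densities `W²` is a squared `L²` distance, which Fubini
rewrites with the kernel `M - max η η'` (`integral_kernel`). With a change of variables in the
entropy this gives `Φ(u) = Ψ(g)`.

The functional `Ψ` also admits slopes whose lifts are not odd. Replacing `G` by its odd part lowers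
each `∫ (G - H i)²` with `H i` odd by the same amount `D = ∫ ((G ω + G (-ω)) / 2)²`. Since `∑_{i<k}
a i = -a k`, the quadratic part drops by `a k / (2τ) * D` whatever the signs of the single
coefficients, and the entropy does not grow, by convexity (`symmetrize`). Hence minimizers of `Ψ`
have odd lifts.

For nonsymmetric `u` the lift is shifted so that it is optimally coupled to the one iterate whose
coefficient may be negative. The other iterates have nonnegative coefficients, for which `W² ≤ ∫ (G
- H)²` has the right direction, and symmetrization applies again (`exists_symDensity_le_phi`). -/

namespace BDFWasserstein

/-! ### Lifts: increasing maps of the line that commute with periods -/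

/-- `G` is a primitive of the positive `M`-periodic function `g`, and `G` grows by `L` over a
period. -/
structure IsLift (M L : ℝ) (g G : ℝ → ℝ) : Prop where
  meas : Measurable g
  pos : ∀ ω, 0 < g ω
  periodic : Function.Periodic g M
  int : ∀ a b, IntervalIntegrable g volume a b
  integral : ∀ a b, ∫ ω in a..b, g ω = G b - G a
  add : ∀ ω, G (ω + M) = G ω + L

namespace IsLift

variable {M L : ℝ} {g G : ℝ → ℝ}

theorem continuous (hG : IsLift M L g G) : Continuous G := by
  have h1 : G = fun ω => G 0 + ∫ η in (0 : ℝ)..ω, g η := by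
    funext ω; rw [hG.integral]; ring
  rw [h1]
  exact continuous_const.add (intervalIntegral.continuous_primitive hG.int 0)

theorem strictMono (hG : IsLift M L g G) : StrictMono G := by
  intro a b hab
  have := intervalIntegral.intervalIntegral_pos_of_pos (hG.int a b) hG.pos hab
  rw [hG.integral] at this
  linarith

theorem add_int (hG : IsLift M L g G) (n : ℤ) (ω : ℝ) : G (ω + n * M) = G ω + n * L := by
  have hnat : ∀ (n : ℕ) (ω : ℝ), G (ω + n * M) = G ω + n * L := by
    intro n
    induction n with
    | zero => intro ω; simp
    | succ n ih =>
      intro ω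
      have h := hG.add (ω + n * M)
      have h2 : ω + ((n + 1 : ℕ) : ℝ) * M = ω + n * M + M := by push_cast; ring
      rw [h2, h, ih]; push_cast; ring
  obtain ⟨n, rfl | rfl⟩ := n.eq_nat_or_neg
  · simpa using hnat n ω
  · have h := hnat n (ω + -(n : ℝ) * M)
    have h2 : ω + -(n : ℝ) * M + n * M = ω := by ring
    rw [h2] at h
    push_cast
    linarith

theorem growth_pos (hG : IsLift M L g G) (hM : 0 < M) : 0 < L := by
  have := hG.strictMono (show (0 : ℝ) < 0 + M by linarith)
  rw [hG.add] at this
  linarith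

theorem surjective (hG : IsLift M L g G) (hM : 0 < M) : Function.Surjective G := by
  have hL := hG.growth_pos hM
  intro y
  obtain ⟨n, hn⟩ := exists_int_gt ((y - G 0) / L)
  obtain ⟨m, hm⟩ := exists_int_lt ((y - G 0) / L)
  rw [div_lt_iff₀ hL] at hn
  rw [lt_div_iff₀ hL] at hm
  have h1 := hG.add_int n 0
  have h2 := hG.add_int m 0
  exact mem_range_of_exists_le_of_exists_ge hG.continuous ⟨0 + m * M, by rw [h2]; linarith⟩
    ⟨0 + n * M, by rw [h1]; linarith⟩

/-- The lift as an order isomorphism of the line. -/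
noncomputable def iso (hG : IsLift M L g G) (hM : 0 < M) : ℝ ≃o ℝ :=
  hG.strictMono.orderIsoOfSurjective G (hG.surjective hM)

theorem apply_symm (hG : IsLift M L g G) (hM : 0 < M) (x : ℝ) : G ((hG.iso hM).symm x) = x :=
  (hG.iso hM).apply_symm_apply x

theorem symm_apply (hG : IsLift M L g G) (hM : 0 < M) (ω : ℝ) : (hG.iso hM).symm (G ω) = ω :=
  (hG.iso hM).symm_apply_apply ω

theorem continuous_symm (hG : IsLift M L g G) (hM : 0 < M) : Continuous (hG.iso hM).symm :=
  (hG.iso hM).symm.continuous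

theorem symm_add (hG : IsLift M L g G) (hM : 0 < M) (x : ℝ) :
    (hG.iso hM).symm (x + L) = (hG.iso hM).symm x + M := by
  apply hG.strictMono.injective
  rw [hG.add, hG.apply_symm, hG.apply_symm]

theorem preimage_Ioc (hG : IsLift M L g G) (a b : ℝ) : G ⁻¹' Set.Ioc (G a) (G b) = Set.Ioc a b := by
  ext ω
  simp [hG.strictMono.lt_iff_lt, hG.strictMono.le_iff_le]

theorem lintegral_Ioc (hG : IsLift M L g G) {a b : ℝ} (hab : a ≤ b) :
    ∫⁻ ω in Set.Ioc a b, ENNReal.ofReal (g ω) = ENNReal.ofReal (G b - G a) := by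
  rw [← hG.integral a b, intervalIntegral.integral_of_le hab, ofReal_integral_eq_lintegral_ofReal]
  · exact (hG.int a b).1
  · exact Filter.Eventually.of_forall fun ω => (hG.pos ω).le

/-- A lift pushes the measure with its density forward to the Lebesgue measure. -/
theorem measurePreserving (hG : IsLift M L g G) (hM : 0 < M) :
    MeasurePreserving G (volume.withDensity fun ω => ENNReal.ofReal (g ω)) volume := by
  refine ⟨hG.continuous.measurable, ?_⟩
  symm
  -- Every interval has the form `(G a, G b]`, and its preimage `(a, b]` has `g`-mass `G b - G a`;
  -- differentiability of `G` is not needed.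
  refine Measure.ext_of_Ioc _ _ fun a b hab => ?_
  obtain ⟨a, rfl⟩ := hG.surjective hM a
  obtain ⟨b, rfl⟩ := hG.surjective hM b
  rw [Measure.map_apply hG.continuous.measurable measurableSet_Ioc, hG.preimage_Ioc,
    withDensity_apply _ measurableSet_Ioc, hG.lintegral_Ioc (hG.strictMono.le_iff_le.1 hab.le),
    Real.volume_Ioc]

theorem measurePreserving_Ioc (hG : IsLift M L g G) (hM : 0 < M) (a b : ℝ) :
    MeasurePreserving G ((volume.restrict (Set.Ioc a b)).withDensity fun ω => ENNReal.ofReal (g ω))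
      (volume.restrict (Set.Ioc (G a) (G b))) := by
  have h := (hG.measurePreserving hM).restrict_preimage (s := Set.Ioc (G a) (G b))
    measurableSet_Ioc
  rwa [hG.preimage_Ioc, restrict_withDensity measurableSet_Ioc] at h

/-- Change of variables. -/
theorem lintegral_comp (hG : IsLift M L g G) (hM : 0 < M) {f : ℝ → ENNReal} (hf : Measurable f)
    (a b : ℝ) :
    ∫⁻ x in Set.Ioc (G a) (G b), f x =
      ∫⁻ ω in Set.Ioc a b, ENNReal.ofReal (g ω) * f (G ω) := by
  rw [← (hG.measurePreserving_Ioc hM a b).lintegral_comp hf,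
    ← Function.comp_def f G, lintegral_withDensity_eq_lintegral_mul _ hG.meas.ennreal_ofReal
      (hf.comp hG.continuous.measurable)]
  rfl

/-- The inverse of a lift is a lift. -/
theorem inverse (hG : IsLift M L g G) (hM : 0 < M) :
    IsLift L M (fun x => 1 / g ((hG.iso hM).symm x)) (hG.iso hM).symm := by
  have hmeas : Measurable fun x => 1 / g ((hG.iso hM).symm x) :=
    (hG.meas.comp (hG.continuous_symm hM).measurable).const_div 1
  have hpos : ∀ x, 0 < 1 / g ((hG.iso hM).symm x) := fun x => one_div_pos.2 (hG.pos _)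
  -- Substituting `x = G ω` produces the factor `g ω`, which cancels `1 / g ω`; only the length of
  -- the parameter interval remains.
  have key : ∀ a b, a ≤ b → ∫⁻ x in Set.Ioc a b, ENNReal.ofReal (1 / g ((hG.iso hM).symm x)) =
      ENNReal.ofReal ((hG.iso hM).symm b - (hG.iso hM).symm a) := by
    intro a b hab
    obtain ⟨a, rfl⟩ := hG.surjective hM a
    obtain ⟨b, rfl⟩ := hG.surjective hM b
    rw [hG.lintegral_comp hM hmeas.ennreal_ofReal]
    simp only [hG.symm_apply]
    have : ∀ ω, ENNReal.ofReal (g ω) * ENNReal.ofReal (1 / g ω) = 1 := fun ω => by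
      rw [← ENNReal.ofReal_mul (hG.pos ω).le, mul_one_div_cancel (hG.pos ω).ne', ENNReal.ofReal_one]
    simp only [this]
    simp
  have hint : ∀ a b, a ≤ b →
      IntegrableOn (fun x => 1 / g ((hG.iso hM).symm x)) (Set.Ioc a b) := by
    intro a b hab
    refine ⟨hmeas.aestronglyMeasurable, ?_⟩
    rw [hasFiniteIntegral_iff_ofReal (Filter.Eventually.of_forall fun x => (hpos x).le), key a b hab]
    exact ENNReal.ofReal_lt_top
  have hval : ∀ a b, a ≤ b → ∫ x in a..b, 1 / g ((hG.iso hM).symm x) =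
      (hG.iso hM).symm b - (hG.iso hM).symm a := by
    intro a b hab
    rw [intervalIntegral.integral_of_le hab, integral_eq_lintegral_of_nonneg_ae
      (Filter.Eventually.of_forall fun x => (hpos x).le) hmeas.aestronglyMeasurable, key a b hab,
      ENNReal.toReal_ofReal]
    exact sub_nonneg.2 ((hG.iso hM).symm.monotone hab)
  refine ⟨hmeas, hpos, ?_, ?_, ?_, hG.symm_add hM⟩
  · intro x
    simp only [hG.symm_add hM, hG.periodic _]
  · intro a b
    rcases le_total a b with hab | hab
    · exact (intervalIntegrable_iff_integrableOn_Ioc_of_le hab).2 (hint a b hab)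
    · exact ((intervalIntegrable_iff_integrableOn_Ioc_of_le hab).2 (hint b a hab)).symm
  · intro a b
    rcases le_total a b with hab | hab
    · exact hval a b hab
    · rw [intervalIntegral.integral_symm, hval b a hab]; ring

theorem shift (hG : IsLift M L g G) (θ : ℝ) :
    IsLift M L (fun ω => g (ω + θ)) (fun ω => G (ω + θ)) := by
  refine ⟨hG.meas.comp (measurable_id.add_const θ), fun ω => hG.pos _, fun ω => ?_, fun a b => ?_,
    fun a b => ?_, fun ω => ?_⟩
  · rw [show ω + M + θ = ω + θ + M by ring, hG.periodic]
  · simpa using (hG.int (a + θ) (b + θ)).comp_add_right θ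
  · rw [intervalIntegral.integral_comp_add_right, hG.integral]
  · rw [show ω + M + θ = ω + θ + M by ring, hG.add]

theorem reflect (hG : IsLift M L g G) :
    IsLift M L (fun ω => g (-ω)) (fun ω => -G (-ω)) := by
  refine ⟨hG.meas.comp measurable_neg, fun ω => hG.pos _, fun ω => ?_, fun a b => ?_,
    fun a b => ?_, fun ω => ?_⟩
  · have := hG.periodic (-(ω + M))
    rw [show -(ω + M) + M = -ω by ring] at this
    exact this.symm
  · rw [IntervalIntegrable.iff_comp_neg]
    simpa using hG.int (-a) (-b)
  · rw [intervalIntegral.integral_comp_neg, hG.integral]; ring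
  · have := hG.add (-(ω + M))
    rw [show -(ω + M) + M = -ω by ring] at this
    linarith

theorem average {g' G' : ℝ → ℝ} (hG : IsLift M L g G) (hG' : IsLift M L g' G') :
    IsLift M L (fun ω => (g ω + g' ω) / 2) (fun ω => (G ω + G' ω) / 2) := by
  refine ⟨(hG.meas.add hG'.meas).div_const 2, fun ω => ?_, fun ω => ?_, fun a b => ?_,
    fun a b => ?_, fun ω => ?_⟩
  · have := hG.pos ω; have := hG'.pos ω; linarith
  · simp only [hG.periodic ω, hG'.periodic ω]
  · exact ((hG.int a b).add (hG'.int a b)).div_const 2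
  · rw [intervalIntegral.integral_div, intervalIntegral.integral_add (hG.int a b) (hG'.int a b),
      hG.integral, hG'.integral]; ring
  · rw [hG.add, hG'.add]; ring

end IsLift

/-! ### Periodic extension and integrals over a period -/

/-- The `M`-periodic function that agrees with `g` on `[0,M)`. -/
noncomputable def periodicExt (M : ℝ) (g : ℝ → ℝ) (ω : ℝ) : ℝ := g (M * Int.fract (ω / M))

/-- The primitive of the periodic extension. -/
noncomputable def primitiveExt (M : ℝ) (g : ℝ → ℝ) (ω : ℝ) : ℝ := ∫ η in (0 : ℝ)..ω, periodicExt M g η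

theorem periodicExt_eq {M : ℝ} (g : ℝ → ℝ) {ω : ℝ} (hω : ω ∈ Set.Ico 0 M) :
    periodicExt M g ω = g ω := by
  have hM : 0 < M := hω.1.trans_lt hω.2
  have h : Int.fract (ω / M) = ω / M :=
    Int.fract_eq_self.2 ⟨div_nonneg hω.1 hM.le, (div_lt_one hM).2 hω.2⟩
  rw [periodicExt, h, mul_div_cancel₀ _ hM.ne']

theorem isLift_primitiveExt {M L : ℝ} (hM : 0 < M) {g : ℝ → ℝ} (hmeas : Measurable g)
    (hpos : ∀ ω ∈ Set.Icc 0 M, 0 < g ω) (hint : IntervalIntegrable g volume 0 M)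
    (htot : ∫ ω in (0 : ℝ)..M, g ω = L) : IsLift M L (periodicExt M g) (primitiveExt M g) := by
  have hper : Function.Periodic (periodicExt M g) M := fun ω => by
    simp only [periodicExt, add_div, div_self hM.ne', Int.fract_add_one]
  -- At the endpoint `M` the extension takes the value `g 0`, so agreement on `(0,M]` holds only off
  -- a null set.
  have hae : ∀ᵐ ω ∂volume, ω ∈ Set.Ioc 0 M → g ω = periodicExt M g ω := by
    have : ∀ᵐ ω ∂(volume : Measure ℝ), ω ≠ M := Measure.ae_ne volume M
    filter_upwards [this] with ω h1 h2
    exact (periodicExt_eq g ⟨h2.1.le, lt_of_le_of_ne h2.2 h1⟩).symm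
  have hint0 : IntervalIntegrable (periodicExt M g) volume 0 M := by
    refine hint.congr_ae ?_
    rw [Set.uIoc_of_le hM.le]
    exact (ae_restrict_iff' measurableSet_Ioc).2 hae
  have hall : ∀ a b, IntervalIntegrable (periodicExt M g) volume a b := fun a b =>
    hper.intervalIntegrable₀ hM.ne' hint0 a b
  refine ⟨hmeas.comp ((measurable_id.div_const M).fract.const_mul M), fun ω => hpos _ ?_, hper,
    hall, fun a b => ?_, fun ω => ?_⟩
  · exact ⟨mul_nonneg hM.le (Int.fract_nonneg _), by
      nlinarith [Int.fract_lt_one (ω / M)]⟩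
  · rw [primitiveExt, primitiveExt, intervalIntegral.integral_interval_sub_left (hall _ _) (hall _ _)]
  · rw [primitiveExt, primitiveExt, hper.intervalIntegral_add_eq_add 0 ω hall, zero_add]
    congr 1
    rw [← htot, intervalIntegral.integral_of_le hM.le, intervalIntegral.integral_of_le hM.le]
    exact (setIntegral_congr_ae measurableSet_Ioc hae).symm

theorem primitiveExt_eq {M : ℝ} (g : ℝ → ℝ) {ω : ℝ} (hω : ω ∈ Set.Icc 0 M) :
    primitiveExt M g ω = ∫ η in (0 : ℝ)..ω, g η := by
  refine intervalIntegral.integral_congr_ae ?_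
  have : ∀ᵐ η ∂(volume : Measure ℝ), η ≠ M := Measure.ae_ne volume M
  filter_upwards [this] with η h1 h2
  rw [Set.uIoc_of_le hω.1] at h2
  exact periodicExt_eq g ⟨h2.1.le, lt_of_le_of_ne (h2.2.trans hω.2) h1⟩

theorem primitiveExt_zero (M : ℝ) (g : ℝ → ℝ) : primitiveExt M g 0 = 0 := by
  simp [primitiveExt]

/-- Integrals of periodic functions over a period do not depend on the period. -/
theorem lintegral_period {M : ℝ} (hM : 0 < M) {f : ℝ → ENNReal} (hf : Function.Periodic f M)
    (s t : ℝ) : ∫⁻ ω in Set.Ioc s (s + M), f ω = ∫⁻ ω in Set.Ioc t (t + M), f ω := by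
  have : VAddInvariantMeasure (AddSubgroup.zmultiples M) ℝ volume :=
    ⟨fun c s _ => measure_preimage_add _ _ _⟩
  refine (isAddFundamentalDomain_Ioc hM s).setLIntegral_eq (isAddFundamentalDomain_Ioc hM t) f ?_
  intro ⟨c, hc⟩ ω
  obtain ⟨n, rfl⟩ := AddSubgroup.mem_zmultiples_iff.1 hc
  simpa [AddSubgroup.vadd_def, add_comm] using hf.zsmul n ω

theorem lintegral_period_shift {M : ℝ} (hM : 0 < M) {f : ℝ → ENNReal} (hf : Function.Periodic f M)
    (θ : ℝ) : ∫⁻ ω in Set.Ioc 0 M, f (ω + θ) = ∫⁻ ω in Set.Ioc 0 M, f ω := by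
  have h := (measurePreserving_add_right volume θ).setLIntegral_comp_preimage_emb
    (measurableEmbedding_addRight θ) f (Set.Ioc θ (θ + M))
  have h2 : (fun x => x + θ) ⁻¹' Set.Ioc θ (θ + M) = Set.Ioc 0 M := by
    ext x; simp [add_comm]
  rw [h2] at h
  rw [h, lintegral_period hM hf θ 0, zero_add]

theorem lintegral_period_neg {M : ℝ} (hM : 0 < M) {f : ℝ → ENNReal} (hf : Function.Periodic f M) :
    ∫⁻ ω in Set.Ioc 0 M, f (-ω) = ∫⁻ ω in Set.Ioc 0 M, f ω := by
  have h := (Measure.measurePreserving_neg (volume : Measure ℝ)).setLIntegral_comp_preimage_emb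
    (MeasurableEquiv.neg ℝ).measurableEmbedding f (Set.Ico (-M) 0)
  have h2 : (Neg.neg : ℝ → ℝ) ⁻¹' Set.Ico (-M) 0 = Set.Ioc 0 M := by
    ext x; simp [and_comm]
  rw [h2] at h
  rw [h, Measure.restrict_congr_set (Ico_ae_eq_Ioc (a := -M) (b := 0))]
  have := lintegral_period hM hf (-M) 0
  simpa using this

/-! ### Densities and their measures on the circle -/

/-- The image of the Lebesgue measure on `(0,M]` under `G` modulo one. -/
noncomputable def pushCircle (M : ℝ) (G : ℝ → ℝ) : Measure UnitAddCircle :=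
  (volume.restrict (Set.Ioc 0 M)).map fun ω => (G ω : UnitAddCircle)

theorem continuous_mk : Continuous fun x : ℝ => (x : UnitAddCircle) :=
  AddCircle.continuous_mk' 1

section Densities

variable {M : ℝ} {u u' : UnitAddCircle → ℝ}

theorem toMeasure_univ (hu : u ∈ Densities M) : toMeasure u Set.univ = ENNReal.ofReal M := by
  obtain ⟨-, h0, hi, hM⟩ := hu
  rw [toMeasure, withDensity_apply _ MeasurableSet.univ, Measure.restrict_univ, ← hM,
    ofReal_integral_eq_lintegral_ofReal hi (Filter.Eventually.of_forall h0)]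

theorem toMeasure_congr (h : u =ᵐ[volume] u') : toMeasure u = toMeasure u' :=
  withDensity_congr_ae (h.mono fun x hx => by simp only [hx])

theorem ae_eq_of_toMeasure_eq (hu : Measurable u) (hu' : Measurable u') (h0 : ∀ x, 0 ≤ u x)
    (h0' : ∀ x, 0 ≤ u' x) (hfin : toMeasure u Set.univ ≠ ⊤) (h : toMeasure u = toMeasure u') :
    u =ᵐ[volume] u' := by
  have hfin' : ∫⁻ x, ENNReal.ofReal (u x) ≠ ⊤ := by
    rwa [toMeasure, withDensity_apply _ MeasurableSet.univ, Measure.restrict_univ] at hfin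
  have := (withDensity_eq_iff hu.ennreal_ofReal.aemeasurable hu'.ennreal_ofReal.aemeasurable
    hfin').1 h
  filter_upwards [this] with x hx
  exact (ENNReal.ofReal_eq_ofReal_iff (h0 x) (h0' x)).1 hx

theorem ae_eq_iff_toMeasure_eq (hu : u ∈ Densities M) (hu' : u' ∈ Densities M) :
    u =ᵐ[volume] u' ↔ toMeasure u = toMeasure u' :=
  ⟨toMeasure_congr, ae_eq_of_toMeasure_eq hu.1 hu'.1 hu.2.1 hu'.2.1
    (by rw [toMeasure_univ hu]; exact ENNReal.ofReal_ne_top)⟩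

theorem mem_densities_of_toMeasure (hM : 0 < M) (hu : Measurable u) (h0 : ∀ x, 0 ≤ u x)
    (h : toMeasure u Set.univ = ENNReal.ofReal M) : u ∈ Densities M := by
  rw [toMeasure, withDensity_apply _ MeasurableSet.univ, Measure.restrict_univ] at h
  refine ⟨hu, h0, ⟨hu.aestronglyMeasurable, ?_⟩, ?_⟩
  · rw [hasFiniteIntegral_iff_ofReal (Filter.Eventually.of_forall h0), h]
    exact ENNReal.ofReal_lt_top
  · rw [integral_eq_lintegral_of_nonneg_ae (Filter.Eventually.of_forall h0)
      hu.aestronglyMeasurable, h, ENNReal.toReal_ofReal hM.le]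

theorem symm_iff_map_neg (hu : u ∈ Densities M) :
    (∀ᵐ x, u (-x) = u x) ↔ (toMeasure u).map (fun x => -x) = toMeasure u := by
  have hmap : (toMeasure u).map (fun x => -x) = toMeasure fun x => u (-x) := by
    ext s hs
    rw [Measure.map_apply measurable_neg hs, toMeasure, toMeasure,
      withDensity_apply _ (measurable_neg hs), withDensity_apply _ hs]
    have := (Measure.measurePreserving_neg
      (volume : Measure UnitAddCircle)).setLIntegral_comp_preimage_emb
      (MeasurableEquiv.neg UnitAddCircle).measurableEmbedding
      (fun x => ENNReal.ofReal (u (-x))) s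
    simpa using this
  have hu' : (fun x => u (-x)) ∈ Densities M :=
    ⟨hu.1.comp measurable_neg, fun x => hu.2.1 _, hu.2.2.1.comp_neg,
      by rw [integral_neg_eq_self u]; exact hu.2.2.2⟩
  rw [hmap, ← ae_eq_iff_toMeasure_eq hu' hu]
  rfl

end Densities

theorem indicator_one_congr {A : Set ℝ} {x y : ℝ} (h : x ∈ A ↔ y ∈ A) :
    A.indicator (1 : ℝ → ENNReal) x = A.indicator 1 y := by
  by_cases hy : y ∈ A
  · rw [Set.indicator_of_mem hy, Set.indicator_of_mem (h.2 hy)]; rfl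
  · rw [Set.indicator_of_notMem hy, Set.indicator_of_notMem (mt h.1 hy)]

/-! ### Lifts as parametrizations of measures on the circle -/

namespace IsLift

variable {M : ℝ} {g G : ℝ → ℝ} {u : UnitAddCircle → ℝ}

theorem measurable_mk (hG : IsLift M 1 g G) : Measurable fun ω => (G ω : UnitAddCircle) :=
  (continuous_mk.comp hG.continuous).measurable

theorem mk_add (hG : IsLift M 1 g G) (ω : ℝ) :
    (G (ω + M) : UnitAddCircle) = (G ω : UnitAddCircle) := by
  rw [hG.add]; exact AddCircle.coe_add_period (1 : ℝ) (G ω)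

theorem measurePreserving_mk (hG : IsLift M 1 g G) (hM : 0 < M) :
    MeasurePreserving (fun ω => (G ω : UnitAddCircle))
      ((volume.restrict (Set.Ioc 0 M)).withDensity fun ω => ENNReal.ofReal (g ω)) volume := by
  have h := hG.measurePreserving_Ioc hM 0 M
  have h2 : G M = G 0 + 1 := by simpa using hG.add 0
  rw [h2] at h
  exact (UnitAddCircle.measurePreserving_mk (G 0)).comp h

/-- Positivity of `g` makes Lebesgue measure absolutely continuous with respect to `g dω`, so almost
everywhere statements on the circle pull back to the parameter `ω`. -/
theorem quasiMeasurePreserving_mk (hG : IsLift M 1 g G) (hM : 0 < M) :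
    Measure.QuasiMeasurePreserving (fun ω => (G ω : UnitAddCircle))
      (volume.restrict (Set.Ioc 0 M)) volume := by
  refine (hG.measurePreserving_mk hM).quasiMeasurePreserving.mono_left ?_
  refine withDensity_absolutelyContinuous' hG.meas.ennreal_ofReal.aemeasurable ?_
  exact Filter.Eventually.of_forall fun ω => (ENNReal.ofReal_pos.2 (hG.pos ω)).ne'

theorem lintegral_circle (hG : IsLift M 1 g G) (hM : 0 < M) {f : UnitAddCircle → ENNReal}
    (hf : Measurable f) :
    ∫⁻ x, f x = ∫⁻ ω in Set.Ioc 0 M, ENNReal.ofReal (g ω) * f (G ω) := by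
  rw [← (hG.measurePreserving_mk hM).lintegral_comp hf, ← Function.comp_def f,
    lintegral_withDensity_eq_lintegral_mul _ hG.meas.ennreal_ofReal (hf.comp hG.measurable_mk)]
  rfl

theorem pushCircle_eq_of_ae (hG : IsLift M 1 g G) (hM : 0 < M) (hu : Measurable u)
    (h : ∀ᵐ ω ∂(volume.restrict (Set.Ioc 0 M)), u (G ω : UnitAddCircle) = 1 / g ω) :
    pushCircle M G = toMeasure u := by
  ext s hs
  rw [pushCircle, Measure.map_apply hG.measurable_mk hs, toMeasure, withDensity_apply _ hs,
    ← lintegral_indicator hs, hG.lintegral_circle hM (hu.ennreal_ofReal.indicator hs),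
    ← lintegral_indicator_one (hG.measurable_mk hs)]
  refine lintegral_congr_ae ?_
  filter_upwards [h] with ω hω
  by_cases hs' : (G ω : UnitAddCircle) ∈ s
  · rw [Set.indicator_of_mem hs', Set.indicator_of_mem (by exact hs'), hω,
      ← ENNReal.ofReal_mul (hG.pos ω).le, mul_one_div_cancel (hG.pos ω).ne']
    simp
  · rw [Set.indicator_of_notMem hs', Set.indicator_of_notMem (by exact hs')]
    simp

theorem pushCircle_univ (hG : IsLift M 1 g G) :
    pushCircle M G Set.univ = ENNReal.ofReal M := by
  rw [pushCircle, Measure.map_apply hG.measurable_mk MeasurableSet.univ]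
  simp

/-- The density `1 / g ∘ G⁻¹` of the measure that is parametrized by a lift. -/
theorem exists_density (hG : IsLift M 1 g G) (hM : 0 < M) :
    ∃ u ∈ Densities M, pushCircle M G = toMeasure u ∧
      ∀ ω, u (G ω : UnitAddCircle) = 1 / g ω := by
  have hF := hG.inverse hM
  have hcoe : ∀ x : ℝ, hF.periodic.lift (x : UnitAddCircle) = 1 / g ((hG.iso hM).symm x) :=
    fun x => hF.periodic.lift_coe x
  -- Measurability of the descended function is read off on the fundamental domain `(0,1]`, which is
  -- measurably equivalent to the circle.
  have hrep : hF.periodic.lift = fun x : UnitAddCircle =>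
      1 / g ((hG.iso hM).symm (AddCircle.equivIoc 1 0 x : ℝ)) := by
    funext x
    rw [← hcoe]
    congr 1
    exact (AddCircle.coe_equivIoc (p := (1 : ℝ)) (a := 0)).symm
  have hmeas : Measurable (hF.periodic.lift : UnitAddCircle → ℝ) := by
    rw [hrep]
    exact hF.meas.comp (measurable_subtype_coe.comp (AddCircle.measurableEquivIoc 1 0).measurable)
  have hval : ∀ ω, hF.periodic.lift (G ω : UnitAddCircle) = 1 / g ω := fun ω => by
    rw [hcoe, hG.symm_apply]
  have hpush := hG.pushCircle_eq_of_ae hM hmeas (Filter.Eventually.of_forall hval)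
  refine ⟨hF.periodic.lift, mem_densities_of_toMeasure hM hmeas (fun x => ?_) ?_, hpush, hval⟩
  · rw [hrep]; exact (hF.pos _).le
  · rw [← hpush, hG.pushCircle_univ]

/-- For the converse, the explicit density of `exists_density` has the same measure as `u`, hence
agrees with it almost everywhere, and this pulls back along `G`. -/
theorem ae_iff_pushCircle_eq (hG : IsLift M 1 g G) (hM : 0 < M) (hu : u ∈ Densities M) :
    (∀ᵐ ω ∂(volume.restrict (Set.Ioc 0 M)), u (G ω : UnitAddCircle) = 1 / g ω) ↔
      pushCircle M G = toMeasure u := by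
  refine ⟨hG.pushCircle_eq_of_ae hM hu.1, fun h => ?_⟩
  obtain ⟨v, hv, hpush, hval⟩ := hG.exists_density hM
  have hvu : v =ᵐ[volume] u := (ae_eq_iff_toMeasure_eq hv hu).2 (hpush.symm.trans h)
  filter_upwards [(hG.quasiMeasurePreserving_mk hM).ae hvu] with ω hω
  rw [← hω, hval]

/-- Lifts with the same starting point are determined by their images on the circle. -/
theorem eq_of_pushCircle_eq {g' G' : ℝ → ℝ} (hG : IsLift M 1 g G) (hG' : IsLift M 1 g' G')
    (hM : 0 < M) (h0 : G 0 = 0) (h0' : G' 0 = 0) (h : pushCircle M G = pushCircle M G') :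
    G = G' := by
  -- The image measure of the arc `(0,x]` is the length of the sublevel set of `G`, so it recovers
  -- the distribution function.
  have hrep : ∀ {g G : ℝ → ℝ}, IsLift M 1 g G → G 0 = 0 → ∀ x ∈ Set.Ioc (0 : ℝ) 1,
      pushCircle M G ((fun y => (AddCircle.equivIoc 1 0 y : ℝ)) ⁻¹' Set.Iic x) =
        volume (Set.Ioc 0 M ∩ {ω | G ω ≤ x}) := by
    intro g G hG h0 x hx
    have hm : Measurable fun y : UnitAddCircle => (AddCircle.equivIoc 1 0 y : ℝ) :=
      measurable_subtype_coe.comp (AddCircle.measurableEquivIoc 1 0).measurable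
    have hGM : G M = 1 := by have := hG.add 0; rwa [zero_add, h0, zero_add] at this
    rw [pushCircle, Measure.map_apply hG.measurable_mk (hm measurableSet_Iic),
      Measure.restrict_apply (hG.measurable_mk (hm measurableSet_Iic)), Set.inter_comm]
    congr 1
    ext ω
    simp only [Set.mem_inter_iff, Set.mem_preimage, Set.mem_Iic, Set.mem_ofPred_eq]
    refine and_congr_right fun hω => ?_
    rw [AddCircle.equivIoc_coe_of_mem]
    have h1 := hG.strictMono hω.1
    have h2 := hG.strictMono.monotone hω.2
    rw [h0] at h1
    rw [hGM] at h2
    exact ⟨h1, by simpa using h2⟩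
  have hIoc : ∀ ω ∈ Set.Ioc 0 M, G ω = G' ω := by
    intro ω hω
    have hGM : G M = 1 := by have := hG.add 0; rwa [zero_add, h0, zero_add] at this
    have hGM' : G' M = 1 := by have := hG'.add 0; rwa [zero_add, h0', zero_add] at this
    have hx : G ω ∈ Set.Ioc (0 : ℝ) 1 :=
      ⟨h0 ▸ hG.strictMono hω.1, hGM ▸ hG.strictMono.monotone hω.2⟩
    have h1 := hrep hG h0 _ hx
    have h2 := hrep hG' h0' _ hx
    rw [h, h2] at h1
    -- With `G' η = G ω` the two sublevel sets are `(0,η]` and `(0,ω]`; equal length forces `η = ω`.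
    obtain ⟨η, hη⟩ := hG'.surjective hM (G ω)
    rw [← hη] at h1 hx
    have hη0 : 0 < η := hG'.strictMono.lt_iff_lt.1 (h0'.symm ▸ hx.1)
    have hηM : η ≤ M := hG'.strictMono.le_iff_le.1 (hGM'.symm ▸ hx.2)
    have e1 : Set.Ioc 0 M ∩ {ω | G' ω ≤ G' η} = Set.Ioc 0 η := by
      ext t
      simp only [Set.mem_inter_iff, Set.mem_Ioc, Set.mem_ofPred_eq, hG'.strictMono.le_iff_le]
      exact ⟨fun h => ⟨h.1.1, h.2⟩, fun h => ⟨⟨h.1, h.2.trans hηM⟩, h.2⟩⟩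
    have e2 : Set.Ioc 0 M ∩ {t | G t ≤ G' η} = Set.Ioc 0 ω := by
      ext t
      simp only [Set.mem_inter_iff, Set.mem_Ioc, Set.mem_ofPred_eq, hη, hG.strictMono.le_iff_le]
      exact ⟨fun h => ⟨h.1.1, h.2⟩, fun h => ⟨⟨h.1, h.2.trans hω.2⟩, h.2⟩⟩
    rw [e1, e2, Real.volume_Ioc, Real.volume_Ioc, sub_zero, sub_zero,
      ENNReal.ofReal_eq_ofReal_iff hη0.le hω.1.le] at h1
    rw [← hη, h1]
  funext ω
  obtain ⟨n, hn, -⟩ := existsUnique_add_zsmul_mem_Ioc hM ω 0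
  rw [zero_add, zsmul_eq_mul] at hn
  have := hIoc _ hn
  rw [hG.add_int, hG'.add_int] at this
  linarith

/-- A measure determines its lift only up to the starting point; this freedom is used later to
choose an optimally coupled lift. -/
theorem pushCircle_shift (hG : IsLift M 1 g G) (hM : 0 < M) (θ : ℝ) :
    pushCircle M (fun ω => G (ω + θ)) = pushCircle M G := by
  ext s hs
  rw [pushCircle, pushCircle, Measure.map_apply (hG.shift θ).measurable_mk hs,
    Measure.map_apply hG.measurable_mk hs, ← lintegral_indicator_one (hG.measurable_mk hs),
    ← lintegral_indicator_one ((hG.shift θ).measurable_mk hs)]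
  refine lintegral_period_shift hM
    (f := ((fun ω => (G ω : UnitAddCircle)) ⁻¹' s).indicator 1) (fun ω => ?_) θ
  have h : ω + M ∈ (fun ω => (G ω : UnitAddCircle)) ⁻¹' s ↔
      ω ∈ (fun ω => (G ω : UnitAddCircle)) ⁻¹' s := by
    simp only [Set.mem_preimage, hG.mk_add]
  exact indicator_one_congr h

theorem pushCircle_reflect (hG : IsLift M 1 g G) (hM : 0 < M) :
    pushCircle M (fun ω => -G (-ω)) = (pushCircle M G).map fun x => -x := by
  ext s hs
  have hs' : MeasurableSet ((fun x : UnitAddCircle => -x) ⁻¹' s) := measurable_neg hs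
  rw [pushCircle, pushCircle, Measure.map_apply hG.reflect.measurable_mk hs,
    Measure.map_apply measurable_neg hs, Measure.map_apply hG.measurable_mk hs',
    ← lintegral_indicator_one (hG.measurable_mk hs'),
    ← lintegral_indicator_one (hG.reflect.measurable_mk hs)]
  refine lintegral_period_neg hM
    (f := ((fun ω => (G ω : UnitAddCircle)) ⁻¹' ((fun x => -x) ⁻¹' s)).indicator 1) (fun ω => ?_)
  have h : ω + M ∈ (fun ω => (G ω : UnitAddCircle)) ⁻¹' ((fun x => -x) ⁻¹' s) ↔
      ω ∈ (fun ω => (G ω : UnitAddCircle)) ⁻¹' ((fun x => -x) ⁻¹' s) := by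
    simp only [Set.mem_preimage, hG.mk_add]
  exact indicator_one_congr h

/-- The lift `ω ↦ -G (-ω)` parametrizes the mirrored measure and also starts at zero, so by
uniqueness it equals `G` exactly when the measure is symmetric. -/
theorem symm_iff_odd (hG : IsLift M 1 g G) (hM : 0 < M) (h0 : G 0 = 0) (hu : u ∈ Densities M)
    (h : pushCircle M G = toMeasure u) : u ∈ SymDensities M ↔ ∀ ω, G (-ω) = -G ω := by
  have h1 : u ∈ SymDensities M ↔ pushCircle M (fun ω => -G (-ω)) = pushCircle M G := by
    rw [hG.pushCircle_reflect hM, h, ← symm_iff_map_neg hu]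
    exact ⟨fun h => h.2, fun h => ⟨hu, h⟩⟩
  rw [h1]
  constructor
  · intro h2 ω
    have := congrFun (hG.reflect.eq_of_pushCircle_eq hG hM (by simp [h0]) h0 h2) ω
    linarith
  · intro h2
    congr 1
    funext ω
    rw [h2, neg_neg]

theorem periodicExt_eq_self (hG : IsLift M 1 g G) (hM : 0 < M) : periodicExt M g = g := by
  funext ω
  have h : M * Int.fract (ω / M) = ω - ⌊ω / M⌋ * M := by
    rw [Int.fract, mul_sub, mul_div_cancel₀ _ hM.ne', mul_comm M]
  rw [periodicExt, h, hG.periodic.sub_int_mul_eq]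

theorem primitiveExt_eq_self (hG : IsLift M 1 g G) (hM : 0 < M) (h0 : G 0 = 0) :
    primitiveExt M g = G := by
  funext ω
  rw [primitiveExt, hG.periodicExt_eq_self hM, hG.integral, h0, sub_zero]

theorem mem_slopes (hG : IsLift M 1 g G) : g ∈ Slopes M := by
  refine ⟨hG.meas, fun ω _ => hG.pos ω, hG.int 0 M, ?_⟩
  have := hG.add 0
  rw [zero_add] at this
  rw [hG.integral, this]; ring

end IsLift

/-! ### The correspondence of positive densities and slopes -/

section Correspondence

variable {M : ℝ} {g g' : ℝ → ℝ} {u u' : UnitAddCircle → ℝ}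

theorem isLift_of_mem_slopes (hM : 0 < M) (hg : g ∈ Slopes M) :
    IsLift M 1 (periodicExt M g) (primitiveExt M g) :=
  isLift_primitiveExt hM hg.1 hg.2.1 hg.2.2.1 hg.2.2.2

theorem periodicExt_ae_eq (M : ℝ) (g : ℝ → ℝ) :
    ∀ᵐ ω ∂(volume.restrict (Set.Ioc 0 M)), periodicExt M g ω = g ω := by
  have : ∀ᵐ ω ∂(volume : Measure ℝ), ω ≠ M := Measure.ae_ne volume M
  rw [ae_restrict_iff' measurableSet_Ioc]
  filter_upwards [this] with ω h1 h2
  exact periodicExt_eq g ⟨h2.1.le, lt_of_le_of_ne h2.2 h1⟩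

theorem related_iff_ae (M : ℝ) (u : UnitAddCircle → ℝ) (g : ℝ → ℝ) :
    Related M u g ↔ ∀ᵐ ω ∂(volume.restrict (Set.Ioc 0 M)),
      u (primitiveExt M g ω : UnitAddCircle) = 1 / periodicExt M g ω := by
  rw [Related, Measure.restrict_congr_set (Ioc_ae_eq_Icc (a := (0 : ℝ)) (b := M)).symm]
  have h1 : ∀ᵐ ω ∂(volume.restrict (Set.Ioc 0 M)), ω ∈ Set.Ioc 0 M :=
    ae_restrict_mem measurableSet_Ioc
  constructor
  · intro h
    filter_upwards [h, h1, periodicExt_ae_eq M g] with ω h2 h3 h4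
    rw [primitiveExt_eq g ⟨h3.1.le, h3.2⟩, h4, h2]
  · intro h
    filter_upwards [h, h1, periodicExt_ae_eq M g] with ω h2 h3 h4
    rw [primitiveExt_eq g ⟨h3.1.le, h3.2⟩, h4] at h2
    exact h2

theorem related_iff_pushCircle (hM : 0 < M) (hu : u ∈ Densities M) (hg : g ∈ Slopes M) :
    Related M u g ↔ pushCircle M (primitiveExt M g) = toMeasure u := by
  rw [related_iff_ae]
  exact (isLift_of_mem_slopes hM hg).ae_iff_pushCircle_eq hM hu

theorem exists_density_of_slope (hM : 0 < M) (hg : g ∈ Slopes M) :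
    ∃ u ∈ Densities M, Related M u g := by
  obtain ⟨u, hu, h, -⟩ := (isLift_of_mem_slopes hM hg).exists_density hM
  exact ⟨u, hu, (related_iff_pushCircle hM hu hg).2 h⟩

/-- The slope is the density of the inverse of the distribution function of `u`, and the inverse of
a lift is a lift. -/
theorem exists_slope_of_density (hM : 0 < M) (hu : u ∈ Densities M) (hpos : ∀ᵐ x, 0 < u x) :
    ∃ g ∈ Slopes M, Related M u g := by
  -- A lift needs a density that is positive everywhere; the value 1 replaces `u` only on a null
  -- set.
  let w : ℝ → ℝ := fun x => if 0 < u (x : UnitAddCircle) then u (x : UnitAddCircle) else 1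
  have hum : Measurable fun x : ℝ => u (x : UnitAddCircle) := hu.1.comp continuous_mk.measurable
  have hwm : Measurable w := Measurable.ite (measurableSet_lt measurable_const hum) hum
    measurable_const
  have hwpos : ∀ x, 0 < w x := fun x => by
    simp only [w]; split_ifs with h
    · exact h
    · exact one_pos
  have hae : ∀ᵐ x : ℝ ∂(volume.restrict (Set.Ioc (0 : ℝ) 1)), u (x : UnitAddCircle) = w x := by
    have h := (UnitAddCircle.measurePreserving_mk 0).quasiMeasurePreserving.ae hpos
    rw [zero_add] at h
    filter_upwards [h] with x hx
    simp only [w]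
    rw [if_pos hx]
  have hui : IntegrableOn (fun x : ℝ => u (x : UnitAddCircle)) (Set.Ioc 0 1) := by
    have h := (UnitAddCircle.measurePreserving_mk 0).integrable_comp_of_integrable hu.2.2.1
    rw [zero_add] at h
    exact h
  have hwi : IntervalIntegrable w volume 0 1 :=
    (intervalIntegrable_iff_integrableOn_Ioc_of_le zero_le_one).2 (hui.congr hae)
  have htot : ∫ x in (0 : ℝ)..1, w x = M := by
    rw [intervalIntegral.integral_of_le zero_le_one, ← integral_congr_ae hae, ← hu.2.2.2,
      ← UnitAddCircle.integral_preimage 0, zero_add]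
  have hU := isLift_primitiveExt one_pos hwm (fun x _ => hwpos x) hwi htot
  have hG := hU.inverse one_pos
  set G := (hU.iso one_pos).symm with hGdef
  have hG0 : G 0 = 0 := by
    have := hU.symm_apply one_pos 0
    rwa [primitiveExt_zero] at this
  refine ⟨_, hG.mem_slopes, ?_⟩
  rw [related_iff_pushCircle hM hu hG.mem_slopes, hG.primitiveExt_eq_self hM hG0]
  refine hG.pushCircle_eq_of_ae hM hu.1 ?_
  have hww : periodicExt 1 w = w := by
    funext x
    have hp : Function.Periodic w 1 := fun y => by
      have : ((y + 1 : ℝ) : UnitAddCircle) = (y : UnitAddCircle) :=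
        AddCircle.coe_add_period (1 : ℝ) y
      simp only [w, this]
    have h : 1 * Int.fract (x / 1) = x - ⌊x⌋ * 1 := by rw [one_mul, div_one, mul_one]; rfl
    rw [periodicExt, h, hp.sub_int_mul_eq]
  have hpos' : ∀ᵐ x : UnitAddCircle, u x = if 0 < u x then u x else 1 := by
    filter_upwards [hpos] with x hx
    rw [if_pos hx]
  filter_upwards [(hG.quasiMeasurePreserving_mk hM).ae hpos'] with ω hω
  rw [hww, one_div_one_div]
  exact hω

theorem related_unique (hM : 0 < M) (hu : u ∈ Densities M) (hu' : u' ∈ Densities M)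
    (hg : g ∈ Slopes M) (hg' : g' ∈ Slopes M) (h : Related M u g) (h' : Related M u' g') :
    u =ᵐ[volume] u' ↔ g =ᵐ[volume.restrict (Set.Icc 0 M)] g' := by
  have hp := (related_iff_pushCircle hM hu hg).1 h
  have hp' := (related_iff_pushCircle hM hu' hg').1 h'
  have hG := isLift_of_mem_slopes hM hg
  have hG' := isLift_of_mem_slopes hM hg'
  rw [Measure.restrict_congr_set (Ioc_ae_eq_Icc (a := (0 : ℝ)) (b := M)).symm]
  constructor
  · intro huu
    have hGG := hG.eq_of_pushCircle_eq hG' hM (primitiveExt_zero M g) (primitiveExt_zero M g')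
      (by rw [hp, hp', toMeasure_congr huu])
    filter_upwards [(related_iff_ae M u g).1 h, (related_iff_ae M u' g').1 h',
      periodicExt_ae_eq M g, periodicExt_ae_eq M g',
      (hG.quasiMeasurePreserving_mk hM).ae huu] with ω h1 h2 h3 h4 h5
    rw [← hGG, ← h5, h1, h3, h4] at h2
    exact inv_injective (by simpa using h2)
  · intro hgg
    rw [ae_eq_iff_toMeasure_eq hu hu', ← hp, ← hp']
    refine Measure.map_congr ?_
    filter_upwards [ae_restrict_mem measurableSet_Ioc] with ω hω
    rw [primitiveExt_eq g ⟨hω.1.le, hω.2⟩, primitiveExt_eq g' ⟨hω.1.le, hω.2⟩]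
    congr 1
    rw [intervalIntegral.integral_of_le hω.1.le, intervalIntegral.integral_of_le hω.1.le]
    exact integral_congr_ae (ae_restrict_of_ae_restrict_of_subset
      (Set.Ioc_subset_Ioc_right hω.2) hgg)

end Correspondence

/-! ### Kantorovich potentials on the circle -/

section Potentials

/-- The Kantorovich potential `φ(x) = ∫_0^x 2(s - T(s)) ds` of a monotone map `T`. -/
noncomputable def potential (T : ℝ → ℝ) (x : ℝ) : ℝ := ∫ s in (0 : ℝ)..x, 2 * (s - T s)

/-- The conjugate potential `ψ(y) = |S(y) - y|² - φ(S(y))`, where `S` is the inverse of `T`. -/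
noncomputable def conjPotential (T S : ℝ → ℝ) (y : ℝ) : ℝ := (S y - y) ^ 2 - potential T (S y)

variable {T S : ℝ → ℝ}

theorem continuous_potential (hT : Continuous T) : Continuous (potential T) :=
  intervalIntegral.continuous_primitive
    (fun a b => Continuous.intervalIntegrable (by fun_prop) a b) 0

theorem continuous_conjPotential (hT : Continuous T) (hS : Continuous S) :
    Continuous (conjPotential T S) :=
  ((hS.sub continuous_id).pow 2).sub ((continuous_potential hT).comp hS)

/-- Over a period the potential grows by minus twice the mean displacement, so the mean-zero
condition is what lets it descend to the circle. -/
theorem potential_periodic (hT : Continuous T) (hT1 : ∀ x, T (x + 1) = T x + 1)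
    (hmean : ∫ x in (0 : ℝ)..1, (T x - x) = 0) : Function.Periodic (potential T) 1 := by
  have hp : Function.Periodic (fun s => 2 * (s - T s)) 1 := fun s => by
    simp only [hT1]; ring
  intro x
  rw [potential, hp.intervalIntegral_add_eq_add 0 x
    (fun a b => Continuous.intervalIntegrable (by fun_prop) a b), zero_add]
  have : ∫ s in (0 : ℝ)..1, 2 * (s - T s) = 0 := by
    rw [intervalIntegral.integral_const_mul]
    have h2 : ∀ s, s - T s = -(T s - s) := fun s => by ring
    simp only [h2, intervalIntegral.integral_neg, hmean]
    simp
  rw [this, add_zero, potential]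

theorem conjPotential_periodic (hφ : Function.Periodic (potential T) 1)
    (hS1 : ∀ y, S (y + 1) = S y + 1) : Function.Periodic (conjPotential T S) 1 := fun y => by
  rw [conjPotential, conjPotential, hS1, hφ]; ring

/-- As a function of `x`, `(x - y)² - φ(x)` has derivative `2 (T x - y)`, which changes sign from
nonpositive to nonnegative at `x = S y`. The minimum is therefore attained there, and its value is
the conjugate potential. -/
theorem potential_add_conj_le (hT : Continuous T) (hmono : Monotone T) (hTS : ∀ y, T (S y) = y)
    (x y : ℝ) : potential T x + conjPotential T S y ≤ (x - y) ^ 2 := by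
  have hint : ∀ a b, IntervalIntegrable (fun s => 2 * (s - T s)) volume a b :=
    fun a b => Continuous.intervalIntegrable (by fun_prop) a b
  have h1 : potential T x - potential T (S y) = ∫ s in (S y)..x, 2 * (s - T s) := by
    rw [potential, potential, intervalIntegral.integral_interval_sub_left (hint _ _) (hint _ _)]
  have h2 : (x - y) ^ 2 - (S y - y) ^ 2 = ∫ s in (S y)..x, 2 * (s - y) := by
    rw [intervalIntegral.integral_const_mul, intervalIntegral.integral_sub
      (Continuous.intervalIntegrable (by fun_prop) _ _)
      (Continuous.intervalIntegrable (by fun_prop) _ _), integral_id]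
    simp
    ring
  have h3 : 0 ≤ ∫ s in (S y)..x, (2 * (s - y) - 2 * (s - T s)) := by
    have h4 : ∀ s, 2 * (s - y) - 2 * (s - T s) = 2 * (T s - y) := fun s => by ring
    simp only [h4]
    rcases le_total (S y) x with h | h
    · refine intervalIntegral.integral_nonneg h fun s hs => ?_
      have := hmono hs.1
      rw [hTS] at this
      linarith
    · rw [intervalIntegral.integral_symm, ← intervalIntegral.integral_neg]
      refine intervalIntegral.integral_nonneg h fun s hs => ?_
      have := hmono hs.2
      rw [hTS] at this
      linarith
  rw [intervalIntegral.integral_sub (Continuous.intervalIntegrable (by fun_prop) _ _) (hint _ _),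
    ← h1, ← h2] at h3
  rw [conjPotential]
  linarith

theorem continuous_lift {f : ℝ → ℝ} (hf : Continuous f) (hp : Function.Periodic f 1) :
    Continuous (hp.lift : UnitAddCircle → ℝ) :=
  (QuotientAddGroup.isQuotientMap_mk (G := ℝ) (N := AddSubgroup.zmultiples 1)).continuous_iff.2 hf

/-- The circle distance is the distance on the line after translating `x` by the nearest integer to
`x - y`, and periodic potentials do not see the translation. -/
theorem lift_add_lift_le {φ ψ : ℝ → ℝ} (hφ : Function.Periodic φ 1) (hψ : Function.Periodic ψ 1)
    (h : ∀ x y, φ x + ψ y ≤ (x - y) ^ 2) (x y : UnitAddCircle) :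
    hφ.lift x + hψ.lift y ≤ dist x y ^ 2 := by
  obtain ⟨x, rfl⟩ := QuotientAddGroup.mk_surjective x
  obtain ⟨y, rfl⟩ := QuotientAddGroup.mk_surjective y
  have hd : dist (QuotientAddGroup.mk x : UnitAddCircle) (QuotientAddGroup.mk y) =
      |x - y - round (x - y)| := by
    rw [dist_eq_norm]
    exact UnitAddCircle.norm_eq (x := x - y)
  have h1 := h (x - round (x - y)) y
  have h2 : φ (x - round (x - y)) = φ x := by simpa using hφ.sub_int_mul_eq (round (x - y)) (x := x)
  rw [h2] at h1
  rw [hd, sq_abs]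
  calc _ = φ x + ψ y := rfl
    _ ≤ _ := h1
    _ = _ := by ring

end Potentials

/-! ### Optimal transport between lifts -/

section Transport

variable {M : ℝ} {g G h H : ℝ → ℝ} {u v : UnitAddCircle → ℝ}

theorem isFiniteMeasure_pushCircle (hG : IsLift M 1 g G) : IsFiniteMeasure (pushCircle M G) :=
  ⟨by rw [hG.pushCircle_univ]; exact ENNReal.ofReal_lt_top⟩

theorem integral_pushCircle (hG : IsLift M 1 g G) (hM : 0 < M) {f : UnitAddCircle → ℝ}
    (hf : Continuous f) :
    ∫ x, f x ∂(pushCircle M G) = ∫ ω in (0 : ℝ)..M, f (G ω : UnitAddCircle) := by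
  rw [pushCircle, integral_map hG.measurable_mk.aemeasurable hf.aestronglyMeasurable,
    intervalIntegral.integral_of_le hM.le]

/-- Two lifts define a transport plan. -/
theorem infCost_le (hG : IsLift M 1 g G) (hH : IsLift M 1 h H) (hM : 0 < M) :
    ⨅ π ∈ transportPlans (pushCircle M H) (pushCircle M G), ∫⁻ p, edist p.1 p.2 ^ 2 ∂π ≤
      ENNReal.ofReal (∫ ω in (0 : ℝ)..M, (G ω - H ω) ^ 2) := by
  have hm : Measurable fun ω => ((H ω : UnitAddCircle), (G ω : UnitAddCircle)) :=
    hH.measurable_mk.prodMk hG.measurable_mk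
  refine (iInf₂_le ((volume.restrict (Set.Ioc 0 M)).map
    fun ω => ((H ω : UnitAddCircle), (G ω : UnitAddCircle))) ⟨?_, ?_⟩).trans ?_
  · have hc : Continuous fun p : UnitAddCircle × UnitAddCircle => edist p.1 p.2 ^ 2 := by
      fun_prop
    have hGc := hG.continuous
    have hHc := hH.continuous
    rw [lintegral_map hc.measurable hm, intervalIntegral.integral_of_le hM.le,
      ofReal_integral_eq_lintegral_ofReal
        (Continuous.intervalIntegrable (by fun_prop) 0 M).1
        (Filter.Eventually.of_forall fun ω => sq_nonneg _)]
    refine lintegral_mono fun ω => ?_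
    rw [edist_dist, ← ENNReal.ofReal_pow dist_nonneg]
    refine ENNReal.ofReal_le_ofReal ?_
    have hd : dist (H ω : UnitAddCircle) (G ω : UnitAddCircle) ≤ |H ω - G ω| := by
      rw [dist_eq_norm]
      exact QuotientAddGroup.norm_mk_le_norm (S := AddSubgroup.zmultiples (1 : ℝ)) (m := H ω - G ω)
    calc _ ≤ |H ω - G ω| ^ 2 := by gcongr
      _ = _ := by rw [sq_abs]; ring
  · rw [Measure.map_map measurable_fst hm]; rfl
  · rw [Measure.map_map measurable_snd hm]; rfl

/-- If the map `T = G ∘ H⁻¹` satisfies `∫_0^1 (T(x) - x) dx = 0`, then the plan defined by the two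
lifts is optimal on the circle. -/
theorem le_infCost (hG : IsLift M 1 g G) (hH : IsLift M 1 h H) (hM : 0 < M)
    (hmean : ∫ x in (0 : ℝ)..1, (G ((hH.iso hM).symm x) - x) = 0) :
    ENNReal.ofReal (∫ ω in (0 : ℝ)..M, (G ω - H ω) ^ 2) ≤
      ⨅ π ∈ transportPlans (pushCircle M H) (pushCircle M G), ∫⁻ p, edist p.1 p.2 ^ 2 ∂π := by
  set T : ℝ → ℝ := fun x => G ((hH.iso hM).symm x) with hTdef
  set S : ℝ → ℝ := fun y => H ((hG.iso hM).symm y) with hSdef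
  have hGc := hG.continuous
  have hHc := hH.continuous
  have hT : Continuous T := hGc.comp (hH.continuous_symm hM)
  have hS : Continuous S := hHc.comp (hG.continuous_symm hM)
  have hTS : ∀ y, T (S y) = y := fun y => by
    simp only [hTdef, hSdef, hH.symm_apply, hG.apply_symm]
  have hmono : Monotone T := hG.strictMono.monotone.comp (hH.iso hM).symm.monotone
  have hT1 : ∀ x, T (x + 1) = T x + 1 := fun x => by
    simp only [hTdef, hH.symm_add, hG.add]
  have hS1 : ∀ x, S (x + 1) = S x + 1 := fun x => by
    simp only [hSdef, hG.symm_add, hH.add]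
  have hφ := potential_periodic hT hT1 hmean
  have hψ := conjPotential_periodic hφ hS1
  have hφc := continuous_lift (continuous_potential hT) hφ
  have hψc := continuous_lift (continuous_conjPotential hT hS) hψ
  have hle := lift_add_lift_le hφ hψ (potential_add_conj_le hT hmono hTS)
  refine le_iInf₂ fun π hπ => ?_
  have hfH := isFiniteMeasure_pushCircle hH
  have hfG := isFiniteMeasure_pushCircle hG
  have hπfin : IsFiniteMeasure π := by
    refine ⟨?_⟩
    have : π Set.univ = pushCircle M H Set.univ := by
      rw [← hπ.1, Measure.map_apply measurable_fst MeasurableSet.univ, Set.preimage_univ]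
    rw [this]
    exact measure_lt_top _ _
  have hcost : ∫⁻ p, edist p.1 p.2 ^ 2 ∂π = ENNReal.ofReal (∫ p, dist p.1 p.2 ^ 2 ∂π) := by
    rw [ofReal_integral_eq_lintegral_ofReal]
    · simp only [edist_dist, ENNReal.ofReal_pow dist_nonneg]
    · exact Continuous.integrable_of_hasCompactSupport (by fun_prop)
        (HasCompactSupport.of_compactSpace _)
    · exact Filter.Eventually.of_forall fun p => sq_nonneg _
  rw [hcost]
  refine ENNReal.ofReal_le_ofReal ?_
  have hi1 : Integrable (fun p : UnitAddCircle × UnitAddCircle => hφ.lift p.1) π :=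
    Continuous.integrable_of_hasCompactSupport (by fun_prop) (HasCompactSupport.of_compactSpace _)
  have hi2 : Integrable (fun p : UnitAddCircle × UnitAddCircle => hψ.lift p.2) π :=
    Continuous.integrable_of_hasCompactSupport (by fun_prop) (HasCompactSupport.of_compactSpace _)
  have hm1 : ∫ p, hφ.lift p.1 ∂π = ∫ ω in (0 : ℝ)..M, potential T (H ω) := by
    have := integral_pushCircle hH hM hφc
    rw [← hπ.1, integral_map measurable_fst.aemeasurable hφc.aestronglyMeasurable] at this
    exact this
  have hm2 : ∫ p, hψ.lift p.2 ∂π = ∫ ω in (0 : ℝ)..M, conjPotential T S (G ω) := by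
    have := integral_pushCircle hG hM hψc
    rw [← hπ.2, integral_map measurable_snd.aemeasurable hψc.aestronglyMeasurable] at this
    exact this
  -- Weak duality: along the plan of the two lifts the potential inequality is an equality, and the
  -- potential integrals depend only on the marginals.
  calc ∫ ω in (0 : ℝ)..M, (G ω - H ω) ^ 2
      = ∫ ω in (0 : ℝ)..M, (potential T (H ω) + conjPotential T S (G ω)) := by
        congr 1
        funext ω
        simp only [conjPotential, hSdef, hG.symm_apply]
        ring
    _ = ∫ p, (hφ.lift p.1 + hψ.lift p.2) ∂π := by
        rw [integral_add hi1 hi2, hm1, hm2]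
        exact intervalIntegral.integral_add
          (((continuous_potential hT).comp hHc).intervalIntegrable _ _)
          (((continuous_conjPotential hT hS).comp hGc).intervalIntegrable _ _)
    _ ≤ ∫ p, dist p.1 p.2 ^ 2 ∂π := by
        refine integral_mono (hi1.add hi2) ?_ fun p => hle p.1 p.2
        exact Continuous.integrable_of_hasCompactSupport (by fun_prop)
          (HasCompactSupport.of_compactSpace _)

theorem integral_sq_nonneg (hM : 0 < M) (f : ℝ → ℝ) : 0 ≤ ∫ ω in (0 : ℝ)..M, f ω ^ 2 :=
  intervalIntegral.integral_nonneg hM.le fun _ _ => sq_nonneg _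

theorem W_sq (hv : pushCircle M H = toMeasure v) (hu : pushCircle M G = toMeasure u) :
    W v u ^ 2 = (⨅ π ∈ transportPlans (pushCircle M H) (pushCircle M G),
      ∫⁻ p, edist p.1 p.2 ^ 2 ∂π).toReal := by
  rw [W, wasserstein, Real.sq_sqrt ENNReal.toReal_nonneg, hv, hu]

theorem W_sq_le (hG : IsLift M 1 g G) (hH : IsLift M 1 h H) (hM : 0 < M)
    (hv : pushCircle M H = toMeasure v) (hu : pushCircle M G = toMeasure u) :
    W v u ^ 2 ≤ ∫ ω in (0 : ℝ)..M, (G ω - H ω) ^ 2 := by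
  rw [W_sq hv hu]
  exact ENNReal.toReal_le_of_le_ofReal (integral_sq_nonneg hM _) (infCost_le hG hH hM)

theorem W_sq_eq (hG : IsLift M 1 g G) (hH : IsLift M 1 h H) (hM : 0 < M)
    (hv : pushCircle M H = toMeasure v) (hu : pushCircle M G = toMeasure u)
    (hmean : ∫ x in (0 : ℝ)..1, (G ((hH.iso hM).symm x) - x) = 0) :
    W v u ^ 2 = ∫ ω in (0 : ℝ)..M, (G ω - H ω) ^ 2 := by
  rw [W_sq hv hu, le_antisymm (infCost_le hG hH hM) (le_infCost hG hH hM hmean),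
    ENNReal.toReal_ofReal (integral_sq_nonneg hM _)]

/-- The displacement of an odd map has mean zero. -/
theorem mean_zero_of_odd (hG : IsLift M 1 g G) (hH : IsLift M 1 h H) (hM : 0 < M)
    (hGo : ∀ ω, G (-ω) = -G ω) (hHo : ∀ ω, H (-ω) = -H ω) :
    ∫ x in (0 : ℝ)..1, (G ((hH.iso hM).symm x) - x) = 0 := by
  have hodd : ∀ x, G ((hH.iso hM).symm (-x)) - -x = -(G ((hH.iso hM).symm x) - x) := by
    intro x
    have : (hH.iso hM).symm (-x) = -(hH.iso hM).symm x := by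
      apply hH.strictMono.injective
      rw [hH.apply_symm, hHo, hH.apply_symm]
    rw [this, hGo]; ring
  have hp : Function.Periodic (fun x => G ((hH.iso hM).symm x) - x) 1 := fun x => by
    simp only [hH.symm_add, hG.add]; ring
  have h1 := hp.intervalIntegral_add_eq 0 (-1)
  have h2 : ∫ x in (-1 : ℝ)..0, (G ((hH.iso hM).symm x) - x) =
      -∫ x in (0 : ℝ)..1, (G ((hH.iso hM).symm x) - x) := by
    rw [← intervalIntegral.integral_neg]
    simp only [← hodd]
    rw [intervalIntegral.integral_comp_neg (fun x => G ((hH.iso hM).symm x) - x)]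
    simp
  norm_num at h1
  rw [h2] at h1
  linarith

/-- Some shift of a lift is optimally coupled to a given lift. -/
theorem exists_shift_mean_zero (hG : IsLift M 1 g G) (hH : IsLift M 1 h H) (hM : 0 < M) :
    ∃ θ, ∫ x in (0 : ℝ)..1, (G ((hH.iso hM).symm x + θ) - x) = 0 := by
  have hGc := hG.continuous
  have hHc := hH.continuous_symm hM
  set f : ℝ → ℝ := fun θ => ∫ x in (0 : ℝ)..1, (G ((hH.iso hM).symm x + θ) - x)
  have hf : Continuous f := by
    refine intervalIntegral.continuous_parametric_intervalIntegral_of_continuous' ?_ 0 1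
    fun_prop
  -- A shift by whole periods changes the mean displacement by an arbitrary integer, so the
  -- intermediate value theorem reaches zero.
  have hadd : ∀ n : ℤ, f (n * M) = f 0 + n := by
    intro n
    have h1 : ∀ x, G ((hH.iso hM).symm x + n * M) - x = (G ((hH.iso hM).symm x + 0) - x) + n := by
      intro x
      rw [hG.add_int, add_zero]; ring
    simp only [f, h1]
    rw [intervalIntegral.integral_add (Continuous.intervalIntegrable (by fun_prop) _ _)
      (Continuous.intervalIntegrable (by fun_prop) _ _)]
    simp
  obtain ⟨n, hn⟩ := exists_int_gt (-f 0)
  obtain ⟨m, hm⟩ := exists_int_lt (-f 0)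
  exact mem_range_of_exists_le_of_exists_ge hf ⟨m * M, (hadd m).le.trans (by linarith)⟩
    ⟨n * M, le_trans (by linarith) (hadd n).ge⟩

end Transport

/-! ### The functional in Lagrangian coordinates -/

/-- The quadratic part of the functional in terms of lifts. -/
noncomputable def quadPart (M τ : ℝ) (k : ℕ) (a : ℕ → ℝ) (H : ℕ → ℝ → ℝ) (G : ℝ → ℝ) : ℝ :=
  -(1 / (2 * τ)) * ∑ i ∈ Finset.range k, a i * ∫ ω in (0 : ℝ)..M, (G ω - H i ω) ^ 2

/-- The entropy in Lagrangian coordinates. -/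
noncomputable def entropyPart (M α : ℝ) (g : ℝ → ℝ) : ENNReal :=
  ENNReal.ofReal (1 / (α * (α - 1))) * ∫⁻ ω in Set.Ioc 0 M, ENNReal.ofReal (g ω ^ (1 - α))

/-- The functional in terms of lifts. -/
noncomputable def liftFunctional (M α τ : ℝ) (k : ℕ) (a : ℕ → ℝ) (H : ℕ → ℝ → ℝ) (g G : ℝ → ℝ) :
    EReal :=
  (quadPart M τ k a H G : EReal) + (entropyPart M α g : EReal)

section Fubini

variable {M : ℝ} {f : ℝ → ℝ}

theorem integrable_kernel (hM : 0 < M)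
    (hi : Integrable f (volume.restrict (Set.Ioc 0 M))) :
    Integrable (fun p : ℝ × ℝ => (M - max p.1 p.2) * (f p.1 * f p.2))
      ((volume.restrict (Set.Ioc 0 M)).prod (volume.restrict (Set.Ioc 0 M))) := by
  refine (hi.mul_prod hi).bdd_mul (c := M)
    (Continuous.aestronglyMeasurable (by fun_prop)) ?_
  rw [Measure.prod_restrict]
  filter_upwards [ae_restrict_mem (measurableSet_Ioc.prod measurableSet_Ioc)] with p hp
  have h1 : max p.1 p.2 ≤ M := max_le hp.1.2 hp.2.2
  have h2 : 0 < max p.1 p.2 := lt_max_of_lt_left hp.1.1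
  rw [Real.norm_eq_abs, abs_le]
  constructor <;> linarith

/-- The square of the primitive is a double integral over `η, η' ≤ ω`. After exchanging the
integrals, `ω` ranges over `[max η η', M]`, whose length is the kernel. -/
theorem integral_kernel (hM : 0 < M) (hf : Measurable f)
    (hi : Integrable f (volume.restrict (Set.Ioc 0 M))) :
    ∫ p, (M - max p.1 p.2) * (f p.1 * f p.2)
      ∂((volume.restrict (Set.Ioc 0 M)).prod (volume.restrict (Set.Ioc 0 M))) =
    ∫ ω in (0 : ℝ)..M, (∫ η in (0 : ℝ)..ω, f η) ^ 2 := by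
  set μ : Measure ℝ := volume.restrict (Set.Ioc 0 M) with hμ
  let Θ : ℝ → ℝ × ℝ → ℝ := fun ω p =>
    ((Set.Iic ω).indicator f p.1) * ((Set.Iic ω).indicator f p.2)
  have hK : Measurable fun q : ℝ × ℝ => (Set.Iic q.1).indicator f q.2 := by
    have : (fun q : ℝ × ℝ => (Set.Iic q.1).indicator f q.2) =
        Set.indicator {q : ℝ × ℝ | q.2 ≤ q.1} fun q => f q.2 := rfl
    rw [this]
    exact (hf.comp measurable_snd).indicator (measurableSet_le measurable_snd measurable_fst)
  have hΘm : Measurable (Function.uncurry Θ) :=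
    (hK.comp (measurable_fst.prodMk (measurable_fst.comp measurable_snd))).mul
      (hK.comp (measurable_fst.prodMk (measurable_snd.comp measurable_snd)))
  have hΘi : Integrable (Function.uncurry Θ) (μ.prod (μ.prod μ)) := by
    have h1 : Integrable (fun q : ℝ × (ℝ × ℝ) => f q.2.1 * f q.2.2) (μ.prod (μ.prod μ)) :=
      (hi.mul_prod hi).comp_snd μ
    refine h1.mono hΘm.aestronglyMeasurable (Filter.Eventually.of_forall fun q => ?_)
    simp only [Function.uncurry, Θ, norm_mul]
    gcongr
    · exact norm_indicator_le_norm_self f _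
    · exact norm_indicator_le_norm_self f _
  have hF : ∫ ω in (0 : ℝ)..M, (∫ η in (0 : ℝ)..ω, f η) ^ 2 = ∫ ω, ∫ p, Θ ω p ∂(μ.prod μ) ∂μ := by
    rw [intervalIntegral.integral_of_le hM.le]
    refine setIntegral_congr_fun measurableSet_Ioc fun ω hω => ?_
    simp only [Θ]
    rw [integral_prod_mul, ← sq, integral_indicator measurableSet_Iic, hμ,
      Measure.restrict_restrict measurableSet_Iic, intervalIntegral.integral_of_le hω.1.le]
    congr 3
    ext η
    simp only [Set.mem_inter_iff, Set.mem_Ioc, Set.mem_Iic]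
    exact ⟨fun h => ⟨h.2, h.1, h.2.trans hω.2⟩, fun h => ⟨h.2.1, h.1⟩⟩
  rw [hF, integral_integral_swap hΘi]
  have hae : ∀ᵐ p ∂(μ.prod μ), p ∈ Set.Ioc 0 M ×ˢ Set.Ioc 0 M := by
    rw [hμ, Measure.prod_restrict]
    exact ae_restrict_mem (measurableSet_Ioc.prod measurableSet_Ioc)
  refine integral_congr_ae ?_
  filter_upwards [hae] with p hp
  have h1 : max p.1 p.2 ≤ M := max_le hp.1.2 hp.2.2
  have h2 : 0 < max p.1 p.2 := lt_max_of_lt_left hp.1.1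
  have h3 : ∀ ω, Θ ω p = (Set.Ici (max p.1 p.2)).indicator (fun _ => f p.1 * f p.2) ω := by
    intro ω
    by_cases h : max p.1 p.2 ≤ ω
    · rw [Set.indicator_of_mem (Set.mem_Ici.2 h)]
      simp only [Θ]
      rw [Set.indicator_of_mem (Set.mem_Iic.2 ((le_max_left _ _).trans h)),
        Set.indicator_of_mem (Set.mem_Iic.2 ((le_max_right _ _).trans h))]
    · rw [Set.indicator_of_notMem (mt Set.mem_Ici.1 h)]
      simp only [Θ]
      rw [max_le_iff, not_and_or] at h
      rcases h with h | h
      · rw [Set.indicator_of_notMem (mt Set.mem_Iic.1 h), zero_mul]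
      · rw [Set.indicator_of_notMem (a := p.2) (mt Set.mem_Iic.1 h), mul_zero]
  simp only [h3]
  rw [integral_indicator measurableSet_Ici, setIntegral_const, smul_eq_mul, hμ,
    measureReal_restrict_apply measurableSet_Ici]
  congr 1
  have h4 : Set.Ici (max p.1 p.2) ∩ Set.Ioc 0 M = Set.Icc (max p.1 p.2) M := by
    ext ω
    simp only [Set.mem_inter_iff, Set.mem_Ioc, Set.mem_Ici, Set.mem_Icc]
    exact ⟨fun h => ⟨h.1, h.2.2⟩, fun h => ⟨h.1, h2.trans_le h.1, h.2⟩⟩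
  rw [h4, Real.volume_real_Icc_of_le h1]

theorem psi_eq {α τ : ℝ} {k : ℕ} {a : ℕ → ℝ} {h : ℕ → ℝ → ℝ} {g : ℝ → ℝ} (hM : 0 < M)
    (hg : g ∈ Slopes M) (hh : ∀ i < k, h i ∈ Slopes M) :
    Psi M α τ k a h g = liftFunctional M α τ k a (fun i => primitiveExt M (h i))
      (periodicExt M g) (primitiveExt M g) := by
  have hint : ∀ {f : ℝ → ℝ}, f ∈ Slopes M → Integrable f (volume.restrict (Set.Ioc 0 M)) :=
    fun hf => hf.2.2.1.1
  have hE : ENNReal.ofReal (1 / (α * (α - 1))) *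
      ∫⁻ ω in Set.Icc 0 M, ENNReal.ofReal (g ω ^ (1 - α)) = entropyPart M α (periodicExt M g) := by
    rw [entropyPart, Measure.restrict_congr_set (Ioc_ae_eq_Icc (a := (0 : ℝ)) (b := M)).symm]
    congr 1
    refine lintegral_congr_ae ?_
    filter_upwards [periodicExt_ae_eq M g] with ω hω
    rw [hω]
  rw [Psi, liftFunctional, hE]
  congr 2
  rw [quadPart]
  congr 1
  set μ : Measure ℝ := volume.restrict (Set.Ioc 0 M) with hμ
  have hk : ∀ i ∈ Finset.range k, Integrable (fun p : ℝ × ℝ => a i *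
      ((M - max p.1 p.2) * ((g p.1 - h i p.1) * (g p.2 - h i p.2)))) (μ.prod μ) := by
    intro i hi
    exact (integrable_kernel hM ((hint hg).sub (hint (hh i (Finset.mem_range.1 hi))))).const_mul _
  have hsum : ∀ p : ℝ × ℝ, (M - max p.1 p.2) * ∑ i ∈ Finset.range k, a i *
      ((g p.1 - h i p.1) * (g p.2 - h i p.2)) = ∑ i ∈ Finset.range k, a i *
      ((M - max p.1 p.2) * ((g p.1 - h i p.1) * (g p.2 - h i p.2))) := by
    intro p
    rw [Finset.mul_sum]
    exact Finset.sum_congr rfl fun i _ => by ring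
  simp only [intervalIntegral.integral_of_le hM.le]
  rw [integral_integral (f := fun η η' => (M - max η η') * ∑ i ∈ Finset.range k,
    a i * ((g η - h i η) * (g η' - h i η')))]
  · simp only [hsum]
    rw [integral_finsetSum _ hk]
    refine Finset.sum_congr rfl fun i hi => ?_
    have hhi := hh i (Finset.mem_range.1 hi)
    rw [integral_const_mul]
    congr 1
    rw [integral_kernel (f := fun ω => g ω - h i ω) hM (hg.1.sub hhi.1) ((hint hg).sub (hint hhi)),
      intervalIntegral.integral_of_le hM.le]
    refine setIntegral_congr_fun measurableSet_Ioc fun ω hω => ?_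
    have hsub : Set.uIcc 0 ω ⊆ Set.uIcc 0 M := by
      rw [Set.uIcc_of_le hω.1.le, Set.uIcc_of_le hM.le]
      exact Set.Icc_subset_Icc_right hω.2
    rw [primitiveExt_eq g ⟨hω.1.le, hω.2⟩, primitiveExt_eq (h i) ⟨hω.1.le, hω.2⟩,
      intervalIntegral.integral_sub (hg.2.2.1.mono_set hsub) (hhi.2.2.1.mono_set hsub)]
  · have := integrable_finsetSum _ hk
    refine this.congr (Filter.Eventually.of_forall fun p => ?_)
    exact (hsum p).symm

end Fubini

/-! ### Entropy: change of variables, convexity, finiteness -/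

section Entropy

variable {M α : ℝ} {g G : ℝ → ℝ} {u : UnitAddCircle → ℝ}

theorem entropy_eq (hG : IsLift M 1 g G) (hM : 0 < M) (hu : u ∈ Densities M)
    (h : pushCircle M G = toMeasure u) : entropy α u = entropyPart M α g := by
  rw [entropy, entropyPart, hG.lintegral_circle hM (hu.1.ennreal_ofReal.pow_const α)]
  congr 1
  refine lintegral_congr_ae ?_
  filter_upwards [(hG.ae_iff_pushCircle_eq hM hu).2 h] with ω hω
  have hg := hG.pos ω
  rw [hω, ENNReal.ofReal_rpow_of_pos (one_div_pos.2 hg), ← ENNReal.ofReal_mul hg.le,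
    one_div, Real.inv_rpow hg.le, Real.rpow_sub hg, Real.rpow_one]
  rfl

theorem entropyPart_shift (hG : IsLift M 1 g G) (hM : 0 < M) (θ : ℝ) :
    entropyPart M α (fun ω => g (ω + θ)) = entropyPart M α g := by
  rw [entropyPart, entropyPart]
  congr 1
  exact lintegral_period_shift hM (f := fun ω => ENNReal.ofReal (g ω ^ (1 - α)))
    (fun ω => by simp only [hG.periodic ω]) θ

/-- The power `1 - α` exceeds 1, so it is convex, and reflection preserves the integral over a
period. -/
theorem entropyPart_average_le (hG : IsLift M 1 g G) (hM : 0 < M) (hα : α < 0) :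
    entropyPart M α (fun ω => (g ω + g (-ω)) / 2) ≤ entropyPart M α g := by
  rw [entropyPart, entropyPart]
  gcongr ENNReal.ofReal _ * ?_
  have hper : Function.Periodic (fun ω => ENNReal.ofReal (g ω ^ (1 - α))) M :=
    fun ω => by simp only [hG.periodic ω]
  have hm : Measurable fun ω => ENNReal.ofReal (g ω ^ (1 - α)) :=
    (hG.meas.pow_const _).ennreal_ofReal
  set c : ENNReal := ENNReal.ofReal (1 / 2)
  have hc : c + c = 1 := by
    rw [← ENNReal.ofReal_add (by norm_num) (by norm_num)]; norm_num
  calc ∫⁻ ω in Set.Ioc 0 M, ENNReal.ofReal (((g ω + g (-ω)) / 2) ^ (1 - α))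
      ≤ ∫⁻ ω in Set.Ioc 0 M, (c * ENNReal.ofReal (g ω ^ (1 - α)) +
          c * ENNReal.ofReal (g (-ω) ^ (1 - α))) := by
        refine lintegral_mono fun ω => ?_
        have h1 := hG.pos ω
        have h2 := hG.pos (-ω)
        have h3 := (convexOn_rpow (p := 1 - α) (by linarith)).2 (Set.mem_Ici.2 h1.le)
          (Set.mem_Ici.2 h2.le) one_half_pos.le one_half_pos.le (by norm_num)
        simp only [smul_eq_mul] at h3
        have h4 : (g ω + g (-ω)) / 2 = 1 / 2 * g ω + 1 / 2 * g (-ω) := by ring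
        rw [h4, ← ENNReal.ofReal_mul (by norm_num), ← ENNReal.ofReal_mul (by norm_num),
          ← ENNReal.ofReal_add (by positivity) (by positivity)]
        exact ENNReal.ofReal_le_ofReal h3
    _ = c * (∫⁻ ω in Set.Ioc 0 M, ENNReal.ofReal (g ω ^ (1 - α))) +
          c * ∫⁻ ω in Set.Ioc 0 M, ENNReal.ofReal (g ω ^ (1 - α)) := by
        rw [lintegral_add_left (hm.const_mul c), lintegral_const_mul c hm,
          ← lintegral_period_neg hM hper]
        congr 1
        exact lintegral_const_mul c (hm.comp measurable_neg)
    _ = ∫⁻ ω in Set.Ioc 0 M, ENNReal.ofReal (g ω ^ (1 - α)) := by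
        rw [← add_mul, hc, one_mul]

theorem entropy_const_pos (hα : α < 0) : 0 < 1 / (α * (α - 1)) :=
  one_div_pos.2 (mul_pos_of_neg_of_neg hα (by linarith))

theorem pos_of_entropy_ne_top (hα : α < 0) (hu : u ∈ Densities M) (h : entropy α u ≠ ⊤) :
    ∀ᵐ x, 0 < u x := by
  have h1 : ∫⁻ x, ENNReal.ofReal (u x) ^ α ≠ ⊤ := by
    intro h2
    rw [entropy, h2, ENNReal.mul_top (ENNReal.ofReal_pos.2 (entropy_const_pos hα)).ne'] at h
    exact h rfl
  filter_upwards [ae_lt_top (hu.1.ennreal_ofReal.pow_const α) h1] with x hx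
  by_contra hx0
  rw [ENNReal.ofReal_of_nonpos (not_lt.1 hx0), ENNReal.zero_rpow_of_neg hα] at hx
  exact lt_irrefl _ hx

theorem const_mem_symDensities (hM : 0 < M) : (fun _ => M) ∈ SymDensities M :=
  ⟨⟨measurable_const, fun _ => hM.le, integrable_const M, by
    rw [integral_const, measureReal_def, UnitAddCircle.measure_univ]; simp⟩,
    Filter.Eventually.of_forall fun _ => rfl⟩

theorem entropy_const_ne_top (hM : 0 < M) : entropy α (fun _ => M) ≠ ⊤ := by
  rw [entropy, lintegral_const, UnitAddCircle.measure_univ, mul_one,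
    ENNReal.ofReal_rpow_of_pos hM]
  exact ENNReal.mul_ne_top ENNReal.ofReal_ne_top ENNReal.ofReal_ne_top

end Entropy

/-! ### Symmetrization of lifts -/

section Symmetrization

variable {M α τ : ℝ} {g G h H : ℝ → ℝ}

/-- Splitting `G - H` into its odd and even parts is orthogonal over a period. As `H` is odd, the
even part is that of `G` alone, so the loss does not depend on `H`. -/
theorem integral_sq_average (hG : IsLift M 1 g G) (hH : IsLift M 1 h H)
    (hHo : ∀ ω, H (-ω) = -H ω) :
    ∫ ω in (0 : ℝ)..M, ((G ω + -G (-ω)) / 2 - H ω) ^ 2 =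
      (∫ ω in (0 : ℝ)..M, (G ω - H ω) ^ 2) - ∫ ω in (0 : ℝ)..M, ((G ω + G (-ω)) / 2) ^ 2 := by
  have hGc := hG.continuous
  have hHc := hH.continuous
  have hp : Function.Periodic (fun ω => (G ω - H ω) ^ 2) M := fun ω => by
    simp only [hG.add, hH.add]; ring
  have hrefl : ∫ ω in (0 : ℝ)..M, (G (-ω) - H (-ω)) ^ 2 = ∫ ω in (0 : ℝ)..M, (G ω - H ω) ^ 2 := by
    rw [intervalIntegral.integral_comp_neg fun ω => (G ω - H ω) ^ 2]
    have := hp.intervalIntegral_add_eq (-M) 0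
    simpa using this
  have hpt : ∀ ω, ((G ω + -G (-ω)) / 2 - H ω) ^ 2 =
      (1 / 2 * (G ω - H ω) ^ 2 + 1 / 2 * (G (-ω) - H (-ω)) ^ 2) - ((G ω + G (-ω)) / 2) ^ 2 := by
    intro ω; rw [hHo]; ring
  simp only [hpt]
  rw [intervalIntegral.integral_sub (Continuous.intervalIntegrable (by fun_prop) _ _)
      (Continuous.intervalIntegrable (by fun_prop) _ _),
    intervalIntegral.integral_add (Continuous.intervalIntegrable (by fun_prop) _ _)
      (Continuous.intervalIntegrable (by fun_prop) _ _),
    intervalIntegral.integral_const_mul, intervalIntegral.integral_const_mul, hrefl]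
  ring

theorem quadPart_average {k : ℕ} {a : ℕ → ℝ} (ha : IsStepCoeff k a) {h H : ℕ → ℝ → ℝ}
    (hG : IsLift M 1 g G) (hH : ∀ i < k, IsLift M 1 (h i) (H i))
    (hHo : ∀ i < k, ∀ ω, H i (-ω) = -H i ω) :
    quadPart M τ k a H (fun ω => (G ω + -G (-ω)) / 2) =
      quadPart M τ k a H G - a k / (2 * τ) * ∫ ω in (0 : ℝ)..M, ((G ω + G (-ω)) / 2) ^ 2 := by
  have hsum := ha.1
  rw [Finset.sum_range_succ] at hsum
  rw [quadPart, quadPart]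
  have h1 : ∀ i ∈ Finset.range k, a i * ∫ ω in (0 : ℝ)..M, ((G ω + -G (-ω)) / 2 - H i ω) ^ 2 =
      a i * (∫ ω in (0 : ℝ)..M, (G ω - H i ω) ^ 2) -
        a i * ∫ ω in (0 : ℝ)..M, ((G ω + G (-ω)) / 2) ^ 2 := fun i hi => by
    rw [integral_sq_average hG (hH i (Finset.mem_range.1 hi)) (hHo i (Finset.mem_range.1 hi)),
      mul_sub]
  rw [Finset.sum_congr rfl h1, Finset.sum_sub_distrib, ← Finset.sum_mul,
    show ∑ i ∈ Finset.range k, a i = -a k by linarith]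
  ring

theorem odd_of_integral_eq_zero (hG : IsLift M 1 g G) (hM : 0 < M)
    (h : ∫ ω in (0 : ℝ)..M, ((G ω + G (-ω)) / 2) ^ 2 ≤ 0) (ω : ℝ) : G (-ω) = -G ω := by
  have hGc := hG.continuous
  have hIcc : ∀ ω ∈ Set.Icc 0 M, G ω + G (-ω) = 0 := by
    by_contra! hne
    obtain ⟨c, hc, hc0⟩ := hne
    refine absurd h (not_le.2 (intervalIntegral.integral_pos hM
      (Continuous.continuousOn (by fun_prop)) (fun _ _ => sq_nonneg _) ⟨c, hc, ?_⟩))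
    positivity
  -- Moving `ω` by `n` periods adds `n` to `G ω` and subtracts `n` from `G (-ω)`, so the even part
  -- is periodic.
  obtain ⟨n, hn, -⟩ := existsUnique_add_zsmul_mem_Ioc hM ω 0
  rw [zero_add, zsmul_eq_mul] at hn
  have h1 := hIcc _ ⟨hn.1.le, hn.2⟩
  have h2 := hG.add_int (-n) (-ω)
  rw [show -ω + ((-n : ℤ) : ℝ) * M = -(ω + n * M) by push_cast; ring] at h2
  rw [hG.add_int, h2] at h1
  push_cast at h1
  linarith

/-- The second claim is the equality case: a finite entropy can be cancelled, and since `a k > 0`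
the loss must vanish. -/
theorem symmetrize {k : ℕ} {a : ℕ → ℝ} (ha : IsStepCoeff k a) {h H : ℕ → ℝ → ℝ} (hM : 0 < M)
    (hα : α < 0) (hτ : 0 < τ)
    (hG : IsLift M 1 g G) (hH : ∀ i < k, IsLift M 1 (h i) (H i))
    (hHo : ∀ i < k, ∀ ω, H i (-ω) = -H i ω) :
    liftFunctional M α τ k a H (fun ω => (g ω + g (-ω)) / 2) (fun ω => (G ω + -G (-ω)) / 2) ≤
      liftFunctional M α τ k a H g G ∧
    (entropyPart M α g ≠ ⊤ → liftFunctional M α τ k a H g G ≤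
      liftFunctional M α τ k a H (fun ω => (g ω + g (-ω)) / 2) (fun ω => (G ω + -G (-ω)) / 2) →
      ∀ ω, G (-ω) = -G ω) := by
  have hq := quadPart_average (τ := τ) ha hG hH hHo
  have hE := entropyPart_average_le hG hM hα
  have hD := integral_sq_nonneg hM fun ω => (G ω + G (-ω)) / 2
  have hc : 0 < a k / (2 * τ) := div_pos ha.2 (by linarith)
  rw [liftFunctional, liftFunctional, hq]
  set D := ∫ ω in (0 : ℝ)..M, ((G ω + G (-ω)) / 2) ^ 2 with hDdef
  refine ⟨add_le_add (EReal.coe_le_coe_iff.2 (by nlinarith)) (by exact_mod_cast hE), ?_⟩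
  intro hfin hle
  have hle2 : ((quadPart M τ k a H G : ℝ) : EReal) + (entropyPart M α g : EReal) ≤
      ((quadPart M τ k a H G - a k / (2 * τ) * D : ℝ) : EReal) + (entropyPart M α g : EReal) :=
    hle.trans (add_le_add le_rfl (by exact_mod_cast hE))
  lift entropyPart M α g to NNReal using hfin with e he
  have hle3 : quadPart M τ k a H G + (e : ℝ) ≤ quadPart M τ k a H G - a k / (2 * τ) * D + (e : ℝ) := by
    rw [← EReal.coe_le_coe_iff, EReal.coe_add, EReal.coe_add]
    exact hle2
  refine odd_of_integral_eq_zero hG hM ?_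
  rw [← hDdef]
  by_contra hneg
  have := mul_pos hc (not_le.1 hneg)
  linarith

end Symmetrization

/-- Point-symmetric previous iterates `v₀, …, v_{k-1}` that are related to `h₀, …, h_{k-1}`. -/
def RelatedIterates (M : ℝ) (k : ℕ) (v : ℕ → UnitAddCircle → ℝ) (h : ℕ → ℝ → ℝ) : Prop :=
  ∀ i < k, v i ∈ SymDensities M ∧ h i ∈ Slopes M ∧ Related M (v i) (h i)

/-! ### One step of the scheme -/

section Step

variable {M α τ : ℝ} {k : ℕ} {a : ℕ → ℝ} {v : ℕ → UnitAddCircle → ℝ} {h : ℕ → ℝ → ℝ}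
  {u : UnitAddCircle → ℝ} {g G : ℝ → ℝ}

theorem odd_of_related (hM : 0 < M) (hu : u ∈ SymDensities M) (hg : g ∈ Slopes M)
    (hr : Related M u g) (ω : ℝ) : primitiveExt M g (-ω) = -primitiveExt M g ω :=
  ((isLift_of_mem_slopes hM hg).symm_iff_odd hM (primitiveExt_zero M g) hu.1
    ((related_iff_pushCircle hM hu.1 hg).1 hr)).1 hu ω

/-- Symmetry of both densities makes both lifts odd, so the coupling by `ω` is optimal for every
iterate, whatever the sign of its coefficient. -/
theorem phi_eq_psi (hM : 0 < M) (hv : RelatedIterates M k v h) (hu : u ∈ SymDensities M)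
    (hg : g ∈ Slopes M) (hr : Related M u g) : Phi α τ k a v u = Psi M α τ k a h g := by
  have hp := (related_iff_pushCircle hM hu.1 hg).1 hr
  have hG := isLift_of_mem_slopes hM hg
  rw [psi_eq hM hg fun i hi => (hv i hi).2.1, Phi, liftFunctional, entropy_eq hG hM hu.1 hp,
    quadPart]
  congr 3
  refine Finset.sum_congr rfl fun i hi => ?_
  obtain ⟨h1, h2, h3⟩ := hv i (Finset.mem_range.1 hi)
  rw [W_sq_eq hG (isLift_of_mem_slopes hM h2) hM ((related_iff_pushCircle hM h1.1 h2).1 h3) hp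
    (mean_zero_of_odd hG _ hM (odd_of_related hM hu hg hr) (odd_of_related hM h1 h2 h3))]

/-- The lift need not start at zero, which admits shifted lifts; its odd part starts at zero in any
case and so comes from a slope. -/
theorem exists_symmetrization (hM : 0 < M) (hα : α < 0) (hτ : 0 < τ) (ha : IsStepCoeff k a)
    (hv : RelatedIterates M k v h) (hG : IsLift M 1 g G) :
    ∃ u ∈ SymDensities M, Phi α τ k a v u ≤
        liftFunctional M α τ k a (fun i => primitiveExt M (h i)) g G ∧
      (entropyPart M α g ≠ ⊤ → liftFunctional M α τ k a (fun i => primitiveExt M (h i)) g G ≤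
        Phi α τ k a v u → ∀ ω, G (-ω) = -G ω) := by
  have hA := hG.average hG.reflect
  have h0 : (G 0 + -G (-0)) / 2 = 0 := by simp
  obtain ⟨u, hu, hr⟩ := exists_density_of_slope hM hA.mem_slopes
  have hp := (related_iff_pushCircle hM hu hA.mem_slopes).1 hr
  rw [hA.primitiveExt_eq_self hM h0] at hp
  have hs : u ∈ SymDensities M := (hA.symm_iff_odd hM h0 hu hp).2 fun ω => by
    rw [neg_neg]; ring
  have hval : Phi α τ k a v u = liftFunctional M α τ k a (fun i => primitiveExt M (h i))
      (fun ω => (g ω + g (-ω)) / 2) (fun ω => (G ω + -G (-ω)) / 2) := by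
    rw [phi_eq_psi hM hv hs hA.mem_slopes hr, psi_eq hM hA.mem_slopes fun i hi => (hv i hi).2.1,
      hA.primitiveExt_eq_self hM h0, hA.periodicExt_eq_self hM]
  refine ⟨u, hs, ?_⟩
  rw [hval]
  exact symmetrize ha hM hα hτ hG (fun i hi => isLift_of_mem_slopes hM (hv i hi).2.1)
    fun i hi => odd_of_related hM (hv i hi).1 (hv i hi).2.1 (hv i hi).2.2

theorem exists_symDensity_le_psi (hM : 0 < M) (hα : α < 0) (hτ : 0 < τ) (ha : IsStepCoeff k a)
    (hv : RelatedIterates M k v h) (hg : g ∈ Slopes M) :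
    ∃ u ∈ SymDensities M, Phi α τ k a v u ≤ Psi M α τ k a h g ∧
      (Psi M α τ k a h g ≠ ⊤ → Psi M α τ k a h g ≤ Phi α τ k a v u →
        ∀ ω, primitiveExt M g (-ω) = -primitiveExt M g ω) := by
  obtain ⟨u, hu, h1, h2⟩ := exists_symmetrization hM hα hτ ha hv (isLift_of_mem_slopes hM hg)
  rw [← psi_eq hM hg fun i hi => (hv i hi).2.1] at h1 h2
  refine ⟨u, hu, h1, fun hfin => h2 fun htop => hfin ?_⟩
  rw [psi_eq hM hg fun i hi => (hv i hi).2.1, liftFunctional, htop]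
  exact EReal.coe_add_top _

theorem phi_const_ne_top (hM : 0 < M) : Phi α τ k a v (fun _ => M) ≠ ⊤ := by
  rw [Phi]
  refine (EReal.add_lt_top (EReal.coe_ne_top _) ?_).ne
  rw [ne_eq, EReal.coe_ennreal_eq_top_iff]
  exact entropy_const_ne_top hM

theorem pos_of_phi_ne_top (hα : α < 0) (hu : u ∈ Densities M) (h : Phi α τ k a v u ≠ ⊤) :
    ∀ᵐ x, 0 < u x := by
  refine pos_of_entropy_ne_top hα hu fun htop => h ?_
  rw [Phi, htop]
  exact EReal.coe_add_top _

theorem exists_related_of_phi_ne_top (hM : 0 < M) (hα : α < 0) (hu : u ∈ Densities M)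
    (h : Phi α τ k a v u ≠ ⊤) : ∃ g ∈ Slopes M, Related M u g :=
  exists_slope_of_density hM hu (pos_of_phi_ne_top hα hu h)

theorem phi_ne_top_of_isArgmin (hM : 0 < M) {C : Set (UnitAddCircle → ℝ)}
    (hC : (fun _ => M) ∈ C) (hu : IsArgmin (Phi α τ k a v) C u) : Phi α τ k a v u ≠ ⊤ :=
  ((hu.2 hC).trans_lt (lt_top_iff_ne_top.2 (phi_const_ne_top hM))).ne

theorem psi_ne_top_of_isArgmin (hM : 0 < M) (hv : RelatedIterates M k v h)
    (hg : IsArgmin (Psi M α τ k a h) (Slopes M) g) : Psi M α τ k a h g ≠ ⊤ := by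
  have hc := const_mem_symDensities hM
  obtain ⟨g₀, hg₀, hr⟩ := exists_slope_of_density hM hc.1 (Filter.Eventually.of_forall fun _ => hM)
  have h1 : Psi M α τ k a h g ≤ Psi M α τ k a h g₀ := hg.2 hg₀
  rw [← phi_eq_psi hM hv hc hg₀ hr] at h1
  exact (h1.trans_lt (lt_top_iff_ne_top.2 (phi_const_ne_top hM))).ne

/-- A competitor for `Ψ` may have no symmetric partner, so it is compared through its
symmetrization. A competitor for `Φ` with finite value is almost everywhere positive and has a
related slope. -/
theorem isArgmin_iff (hM : 0 < M) (hα : α < 0) (hτ : 0 < τ) (ha : IsStepCoeff k a)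
    (hv : RelatedIterates M k v h) (hu : u ∈ SymDensities M) (hg : g ∈ Slopes M)
    (hr : Related M u g) : IsArgmin (Phi α τ k a v) (SymDensities M) u ↔
      IsArgmin (Psi M α τ k a h) (Slopes M) g := by
  have heq : Phi α τ k a v u = Psi M α τ k a h g := phi_eq_psi hM hv hu hg hr
  constructor
  · rintro ⟨-, hmin⟩
    refine ⟨hg, fun g' hg' => ?_⟩
    obtain ⟨u', hu', hle, -⟩ := exists_symDensity_le_psi (τ := τ) hM hα hτ ha hv hg'
    exact heq.symm.le.trans ((hmin hu').trans hle)
  · rintro ⟨-, hmin⟩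
    refine ⟨hu, fun u' hu' => ?_⟩
    by_cases htop : Phi α τ k a v u' = ⊤
    · exact le_top.trans htop.ge
    · obtain ⟨g', hg', hr'⟩ := exists_related_of_phi_ne_top hM hα hu'.1 htop
      exact heq.le.trans ((hmin hg').trans (phi_eq_psi hM hv hu' hg' hr').ge)

theorem exists_related_of_isArgmin_phi (hM : 0 < M) (hα : α < 0)
    (hu : IsArgmin (Phi α τ k a v) (SymDensities M) u) : ∃ g ∈ Slopes M, Related M u g :=
  exists_related_of_phi_ne_top hM hα hu.1.1
    (phi_ne_top_of_isArgmin hM (const_mem_symDensities hM) hu)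

/-- A minimizer cannot be improved by symmetrization, so the equality case applies and its lift is
odd. -/
theorem exists_related_of_isArgmin_psi (hM : 0 < M) (hα : α < 0) (hτ : 0 < τ)
    (ha : IsStepCoeff k a) (hv : RelatedIterates M k v h)
    (hg : IsArgmin (Psi M α τ k a h) (Slopes M) g) : ∃ u ∈ SymDensities M, Related M u g := by
  obtain ⟨u', hu', -, hodd⟩ := exists_symDensity_le_psi (τ := τ) hM hα hτ ha hv hg.1
  have hfin := psi_ne_top_of_isArgmin hM hv hg
  have hle : Psi M α τ k a h g ≤ Phi α τ k a v u' := by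
    by_cases htop : Phi α τ k a v u' = ⊤
    · exact le_top.trans htop.ge
    · obtain ⟨g', hg', hr'⟩ := exists_related_of_phi_ne_top hM hα hu'.1 htop
      exact (hg.2 hg').trans (phi_eq_psi hM hv hu' hg' hr').ge
  obtain ⟨u, hu, hr⟩ := exists_density_of_slope hM hg.1
  exact ⟨u, ((isLift_of_mem_slopes hM hg.1).symm_iff_odd hM (primitiveExt_zero M g) hu
    ((related_iff_pushCircle hM hu hg.1).1 hr)).2 (hodd hfin hle), hr⟩

/-- If at most one previous coefficient is negative, then symmetrization does not increase `Φ`. -/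
theorem exists_symDensity_le_phi (hM : 0 < M) (hα : α < 0) (hτ : 0 < τ) (ha : IsStepCoeff k a)
    (hneg : OneNegative k a) (hv : RelatedIterates M k v h) (hu : u ∈ Densities M)
    (hfin : Phi α τ k a v u ≠ ⊤) :
    ∃ u' ∈ SymDensities M, Phi α τ k a v u' ≤ Phi α τ k a v u ∧
      (Phi α τ k a v u ≤ Phi α τ k a v u' → u ∈ SymDensities M) := by
  obtain ⟨j, hj⟩ := hneg
  obtain ⟨g, hg, hr⟩ := exists_related_of_phi_ne_top hM hα hu hfin
  have hG := isLift_of_mem_slopes hM hg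
  have hp := (related_iff_pushCircle hM hu hg).1 hr
  -- If the exceptional index were outside the range, all of `a 0, …, a (k-1)` would be nonnegative,
  -- contradicting `∑ a i = 0` with `a k > 0`.
  have hjk : j < k := by
    by_contra hjk
    have h1 : 0 ≤ ∑ i ∈ Finset.range k, a i := Finset.sum_nonneg fun i hi =>
      hj i (Finset.mem_range.1 hi) fun h => hjk (h ▸ Finset.mem_range.1 hi)
    have h2 := ha.1
    rw [Finset.sum_range_succ] at h2
    linarith [ha.2]
  have hH := fun i hi => isLift_of_mem_slopes hM (hv i hi).2.1
  have hpH := fun i hi => (related_iff_pushCircle hM (hv i hi).1.1 (hv i hi).2.1).1 (hv i hi).2.2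
  -- One shift parameter makes the coupling optimal for one iterate; it is spent on `j`, where an
  -- inequality would point the wrong way.
  obtain ⟨θ, hθ⟩ := exists_shift_mean_zero hG (hH j hjk) hM
  have hS := hG.shift θ
  have hpS : pushCircle M (fun ω => primitiveExt M g (ω + θ)) = toMeasure u :=
    (hG.pushCircle_shift hM θ).trans hp
  have hWj := W_sq_eq hS (hH j hjk) hM (hpH j hjk) hpS hθ
  have haj : a j ≤ 0 := by
    have h1 : 0 ≤ ∑ i ∈ (Finset.range k).erase j, a i := Finset.sum_nonneg fun i hi =>
      hj i (Finset.mem_range.1 (Finset.mem_of_mem_erase hi)) (Finset.ne_of_mem_erase hi)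
    have h2 := ha.1
    rw [Finset.sum_range_succ, ← Finset.add_sum_erase _ _ (Finset.mem_range.2 hjk)] at h2
    linarith [ha.2]
  have hle : liftFunctional M α τ k a (fun i => primitiveExt M (h i))
      (fun ω => periodicExt M g (ω + θ)) (fun ω => primitiveExt M g (ω + θ)) ≤
      Phi α τ k a v u := by
    rw [liftFunctional, Phi, entropyPart_shift hG hM, entropy_eq hG hM hu hp]
    refine add_le_add (EReal.coe_le_coe_iff.2 ?_) le_rfl
    rw [quadPart, neg_mul, neg_mul, neg_le_neg_iff]
    refine mul_le_mul_of_nonneg_left (Finset.sum_le_sum fun i hi => ?_) (by positivity)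
    have hik := Finset.mem_range.1 hi
    by_cases hij : i = j
    · rw [hij, hWj]
    · exact mul_le_mul_of_nonneg_left (W_sq_le hS (hH i hik) hM (hpH i hik) hpS) (hj i hik hij)
  obtain ⟨u', hu', h1, h2⟩ := exists_symmetrization (τ := τ) hM hα hτ ha hv hS
  refine ⟨u', hu', h1.trans hle, fun h3 => ?_⟩
  have hodd := h2 (fun htop => hfin (by
    rw [Phi, entropy_eq hG hM hu hp, ← entropyPart_shift hG hM θ, htop]
    exact EReal.coe_add_top _)) (hle.trans h3)
  -- Oddness at zero makes the shifted lift vanish there, as the symmetry criterion requires.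
  have h0 := hodd 0
  rw [neg_zero] at h0
  exact (hS.symm_iff_odd hM (by linarith) hu hpS).2 hodd

theorem isArgmin_densities_iff (hM : 0 < M) (hα : α < 0) (hτ : 0 < τ) (ha : IsStepCoeff k a)
    (hneg : OneNegative k a) (hv : RelatedIterates M k v h) :
    IsArgmin (Phi α τ k a v) (Densities M) u ↔ IsArgmin (Phi α τ k a v) (SymDensities M) u := by
  constructor
  · intro hu
    obtain ⟨u', hu', -, hs⟩ := exists_symDensity_le_phi hM hα hτ ha hneg hv hu.1
      (phi_ne_top_of_isArgmin hM (const_mem_symDensities hM).1 hu)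
    exact ⟨hs (hu.2 hu'.1), fun w hw => hu.2 hw.1⟩
  · intro hu
    refine ⟨hu.1.1, fun w hw => ?_⟩
    by_cases htop : Phi α τ k a v w = ⊤
    · exact le_top.trans htop.ge
    · obtain ⟨u', hu', hle, -⟩ := exists_symDensity_le_phi hM hα hτ ha hneg hv hw htop
      exact (hu.2 hu').trans hle

end Step

/-! ### The inductive scheme -/

section Scheme

variable {M α τ : ℝ} {r : ℕ → ℕ} {a : ℕ → ℕ → ℝ} {u₀ : UnitAddCircle → ℝ} {g₀ : ℝ → ℝ}
  {u : ℕ → UnitAddCircle → ℝ} {g : ℕ → ℝ → ℝ}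

theorem relatedIterates_of_forall {m : ℕ} (hr : 1 ≤ r m ∧ r m ≤ m)
    (h : ∀ n < m, u n ∈ SymDensities M ∧ g n ∈ Slopes M ∧ Related M (u n) (g n)) :
    RelatedIterates M (r m) (fun i => u (m - r m + i)) fun i => g (m - r m + i) :=
  fun i hi => h _ (by omega)

theorem exists_solvesG (hM : 0 < M) (hα : α < 0) (hτ : 0 < τ)
    (hr : ∀ m, 1 ≤ m → 1 ≤ r m ∧ r m ≤ m) (ha : ∀ m, 1 ≤ m → IsStepCoeff (r m) (a (r m)))
    (hu₀ : u 0 ∈ SymDensities M) (hg₀ : g₀ ∈ Slopes M) (hrel : Related M (u 0) g₀)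
    (hu : SolvesU α τ (SymDensities M) r a u) :
    ∃ g : ℕ → ℝ → ℝ, g 0 = g₀ ∧ SolvesG M α τ r a g ∧ ∀ n, Related M (u n) (g n) := by
  have hex : ∀ n, ∃ g, g ∈ Slopes M ∧ Related M (u (n + 1)) g := fun n =>
    exists_related_of_isArgmin_phi hM hα (hu (n + 1) (Nat.le_add_left 1 n))
  choose w hw hwr using hex
  let g : ℕ → ℝ → ℝ := fun n => Nat.casesOn n g₀ w
  have hall : ∀ n, u n ∈ SymDensities M ∧ g n ∈ Slopes M ∧ Related M (u n) (g n) := by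
    intro n
    cases n with
    | zero => exact ⟨hu₀, hg₀, hrel⟩
    | succ n => exact ⟨(hu (n + 1) (Nat.le_add_left 1 n)).1, hw n, hwr n⟩
  refine ⟨g, rfl, fun m hm => ?_, fun n => (hall n).2.2⟩
  exact (isArgmin_iff hM hα hτ (ha m hm)
    (relatedIterates_of_forall (hr m hm) fun n _ => hall n) (hall m).1 (hall m).2.1
    (hall m).2.2).1 (hu m hm)

theorem exists_solvesU (hM : 0 < M) (hα : α < 0) (hτ : 0 < τ)
    (hr : ∀ m, 1 ≤ m → 1 ≤ r m ∧ r m ≤ m) (ha : ∀ m, 1 ≤ m → IsStepCoeff (r m) (a (r m)))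
    (hu₀ : u₀ ∈ SymDensities M) (hg₀ : g 0 ∈ Slopes M) (hrel : Related M u₀ (g 0))
    (hg : SolvesG M α τ r a g) :
    ∃ u : ℕ → UnitAddCircle → ℝ, u 0 = u₀ ∧ SolvesU α τ (SymDensities M) r a u ∧
      ∀ n, Related M (u n) (g n) := by
  have hmem : ∀ n, g n ∈ Slopes M := by
    intro n
    rcases Nat.eq_zero_or_pos n with rfl | hn
    · exact hg₀
    · exact (hg n hn).1
  -- Strong induction is needed: oddness of the lift of `g n` is derived from symmetric densities
  -- related to the earlier iterates.
  have hex : ∀ n, ∃ u, u ∈ SymDensities M ∧ Related M u (g n) := by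
    intro n
    induction n using Nat.strong_induction_on with
    | _ n ih =>
      rcases Nat.eq_zero_or_pos n with rfl | hn
      · exact ⟨u₀, hu₀, hrel⟩
      · have hex' : ∀ l, ∃ u, l < n → u ∈ SymDensities M ∧ Related M u (g l) := fun l => by
          by_cases hl : l < n
          · obtain ⟨u, hu⟩ := ih l hl
            exact ⟨u, fun _ => hu⟩
          · exact ⟨u₀, fun h => absurd h hl⟩
        choose w hw using hex'
        exact exists_related_of_isArgmin_psi hM hα hτ (ha n hn)
          (relatedIterates_of_forall (u := w) (hr n hn)
            fun l hl => ⟨(hw l hl).1, hmem l, (hw l hl).2⟩) (hg n hn)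
  choose w hw hwr using hex
  -- The choice at index 0 could differ from the prescribed `u₀` on a null set, so it is
  -- overwritten.
  let u : ℕ → UnitAddCircle → ℝ := fun n => Nat.casesOn n u₀ fun n => w (n + 1)
  have hall : ∀ n, u n ∈ SymDensities M ∧ g n ∈ Slopes M ∧ Related M (u n) (g n) := by
    intro n
    cases n with
    | zero => exact ⟨hu₀, hg₀, hrel⟩
    | succ n => exact ⟨hw _, hmem _, hwr _⟩
  refine ⟨u, rfl, fun m hm => ?_, fun n => (hall n).2.2⟩
  exact (isArgmin_iff hM hα hτ (ha m hm)
    (relatedIterates_of_forall (hr m hm) fun n _ => hall n) (hall m).1 (hall m).2.1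
    (hall m).2.2).2 (hg m hm)

theorem solvesU_densities_iff (hM : 0 < M) (hα : α < 0) (hτ : 0 < τ)
    (hr : ∀ m, 1 ≤ m → 1 ≤ r m ∧ r m ≤ m) (ha : ∀ m, 1 ≤ m → IsStepCoeff (r m) (a (r m)))
    (hneg : ∀ m, 1 ≤ m → OneNegative (r m) (a (r m)))
    (hu₀ : u 0 ∈ SymDensities M) (hg₀ : g₀ ∈ Slopes M) (hrel : Related M (u 0) g₀) :
    SolvesU α τ (Densities M) r a u ↔ SolvesU α τ (SymDensities M) r a u := by
  -- The two one-step problems agree only once the earlier iterates are known to be symmetric and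
  -- related to slopes. Starting from minimizers over all densities, this is obtained by induction.
  have step : ∀ m, 1 ≤ m → (∀ n < m, u n ∈ SymDensities M ∧ ∃ g ∈ Slopes M, Related M (u n) g) →
      (IsArgmin (Phi α τ (r m) (a (r m)) fun i => u (m - r m + i)) (Densities M) (u m) ↔
        IsArgmin (Phi α τ (r m) (a (r m)) fun i => u (m - r m + i)) (SymDensities M) (u m)) := by
    intro m hm hall
    have hex : ∀ n, ∃ g, n < m → g ∈ Slopes M ∧ Related M (u n) g := fun n => by
      by_cases hn : n < m
      · obtain ⟨g, hg⟩ := (hall n hn).2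
        exact ⟨g, fun _ => hg⟩
      · exact ⟨g₀, fun h => absurd h hn⟩
    choose w hw using hex
    exact isArgmin_densities_iff hM hα hτ (ha m hm) (hneg m hm)
      (relatedIterates_of_forall (g := w) (hr m hm) fun n hn => ⟨(hall n hn).1, hw n hn⟩)
  constructor
  · intro hu
    have hall : ∀ n, u n ∈ SymDensities M ∧ ∃ g ∈ Slopes M, Related M (u n) g := by
      intro n
      induction n using Nat.strong_induction_on with
      | _ n ih =>
        rcases Nat.eq_zero_or_pos n with rfl | hn
        · exact ⟨hu₀, g₀, hg₀, hrel⟩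
        · have h := (step n hn ih).1 (hu n hn)
          exact ⟨h.1, exists_related_of_isArgmin_phi hM hα h⟩
    exact fun m hm => (step m hm fun n _ => hall n).1 (hu m hm)
  · intro hu m hm
    refine (step m hm fun n _ => ?_).2 (hu m hm)
    rcases Nat.eq_zero_or_pos n with rfl | hn
    · exact ⟨hu₀, g₀, hg₀, hrel⟩
    · exact ⟨(hu n hn).1, exists_related_of_isArgmin_phi hM hα (hu n hn)⟩

end Scheme

end BDFWasserstein
theorem lemma3p1 (M α τ : ℝ) (hM : 0 < M) (hα : α < 0) (hτ : 0 < τ) :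
    -- The relation is a one-to-one correspondence (up to null sets) of positive densities and
    -- admissible functions.
    ((∀ u ∈ BDFWasserstein.Densities M, (∀ᵐ x, 0 < u x) →
        ∃ g ∈ BDFWasserstein.Slopes M, BDFWasserstein.Related M u g) ∧
      (∀ g ∈ BDFWasserstein.Slopes M,
        ∃ u ∈ BDFWasserstein.Densities M, BDFWasserstein.Related M u g) ∧
      (∀ u ∈ BDFWasserstein.Densities M, ∀ u' ∈ BDFWasserstein.Densities M,
        ∀ g ∈ BDFWasserstein.Slopes M, ∀ g' ∈ BDFWasserstein.Slopes M,
        BDFWasserstein.Related M u g → BDFWasserstein.Related M u' g' →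
          (u =ᵐ[volume] u' ↔ g =ᵐ[volume.restrict (Set.Icc 0 M)] g'))) ∧
    -- One step, for arbitrary point-symmetric previous iterates.
    (∀ (k : ℕ) (a : ℕ → ℝ), BDFWasserstein.IsStepCoeff k a →
      ∀ (v : ℕ → UnitAddCircle → ℝ) (h : ℕ → ℝ → ℝ),
      (∀ i < k, v i ∈ BDFWasserstein.SymDensities M ∧ h i ∈ BDFWasserstein.Slopes M ∧
        BDFWasserstein.Related M (v i) (h i)) →
      (∀ u ∈ BDFWasserstein.SymDensities M, ∀ g ∈ BDFWasserstein.Slopes M,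
        BDFWasserstein.Related M u g →
          BDFWasserstein.Phi α τ k a v u = BDFWasserstein.Psi M α τ k a h g ∧
          (BDFWasserstein.IsArgmin (BDFWasserstein.Phi α τ k a v)
              (BDFWasserstein.SymDensities M) u ↔
            BDFWasserstein.IsArgmin (BDFWasserstein.Psi M α τ k a h)
              (BDFWasserstein.Slopes M) g)) ∧
      (∀ u, BDFWasserstein.IsArgmin (BDFWasserstein.Phi α τ k a v)
          (BDFWasserstein.SymDensities M) u →
        ∃ g, BDFWasserstein.IsArgmin (BDFWasserstein.Psi M α τ k a h)
          (BDFWasserstein.Slopes M) g ∧ BDFWasserstein.Related M u g) ∧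
      (∀ g, BDFWasserstein.IsArgmin (BDFWasserstein.Psi M α τ k a h)
          (BDFWasserstein.Slopes M) g →
        ∃ u, BDFWasserstein.IsArgmin (BDFWasserstein.Phi α τ k a v)
          (BDFWasserstein.SymDensities M) u ∧ BDFWasserstein.Related M u g) ∧
      (BDFWasserstein.OneNegative k a → ∀ u,
        BDFWasserstein.IsArgmin (BDFWasserstein.Phi α τ k a v)
            (BDFWasserstein.Densities M) u ↔
          BDFWasserstein.IsArgmin (BDFWasserstein.Phi α τ k a v)
            (BDFWasserstein.SymDensities M) u)) ∧
    -- The inductive `k`-step scheme with lower-order starting steps and point-symmetric initial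
    -- datum.
    (∀ (k : ℕ) (r : ℕ → ℕ) (a : ℕ → ℕ → ℝ), (∀ m, 1 ≤ m → 1 ≤ r m ∧ r m ≤ m) →
      (∀ m, k ≤ m → r m = k) → (∀ m, 1 ≤ m → BDFWasserstein.IsStepCoeff (r m) (a (r m))) →
      ∀ u₀ ∈ BDFWasserstein.SymDensities M, ∀ g₀ ∈ BDFWasserstein.Slopes M,
      BDFWasserstein.Related M u₀ g₀ →
      (∀ u : ℕ → UnitAddCircle → ℝ, u 0 = u₀ →
        BDFWasserstein.SolvesU α τ (BDFWasserstein.SymDensities M) r a u →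
        ∃ g : ℕ → ℝ → ℝ, g 0 = g₀ ∧ BDFWasserstein.SolvesG M α τ r a g ∧
          ∀ n, BDFWasserstein.Related M (u n) (g n)) ∧
      (∀ g : ℕ → ℝ → ℝ, g 0 = g₀ → BDFWasserstein.SolvesG M α τ r a g →
        ∃ u : ℕ → UnitAddCircle → ℝ, u 0 = u₀ ∧
          BDFWasserstein.SolvesU α τ (BDFWasserstein.SymDensities M) r a u ∧
          ∀ n, BDFWasserstein.Related M (u n) (g n)) ∧
      ((∀ m, 1 ≤ m → BDFWasserstein.OneNegative (r m) (a (r m))) →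
        ∀ u : ℕ → UnitAddCircle → ℝ, u 0 = u₀ →
        (BDFWasserstein.SolvesU α τ (BDFWasserstein.Densities M) r a u ↔
          BDFWasserstein.SolvesU α τ (BDFWasserstein.SymDensities M) r a u))) := by
  refine ⟨⟨fun u hu hpos => BDFWasserstein.exists_slope_of_density hM hu hpos,
    fun g hg => BDFWasserstein.exists_density_of_slope hM hg,
    fun u hu u' hu' g hg g' hg' h h' =>
      BDFWasserstein.related_unique hM hu hu' hg hg' h h'⟩, ?_, ?_⟩
  · intro k a ha v h hv
    refine ⟨fun u hu g hg hr => ⟨BDFWasserstein.phi_eq_psi hM hv hu hg hr,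
      BDFWasserstein.isArgmin_iff hM hα hτ ha hv hu hg hr⟩, fun u hu => ?_, fun g hg => ?_,
      fun hneg u => BDFWasserstein.isArgmin_densities_iff hM hα hτ ha hneg hv⟩
    · obtain ⟨g, hg, hr⟩ := BDFWasserstein.exists_related_of_isArgmin_phi hM hα hu
      exact ⟨g, (BDFWasserstein.isArgmin_iff hM hα hτ ha hv hu.1 hg hr).1 hu, hr⟩
    · obtain ⟨u, hu, hr⟩ := BDFWasserstein.exists_related_of_isArgmin_psi hM hα hτ ha hv hg
      exact ⟨u, (BDFWasserstein.isArgmin_iff hM hα hτ ha hv hu hg.1 hr).2 hg, hr⟩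
  · intro k r a hr _ ha u₀ hu₀ g₀ hg₀ hrel
    refine ⟨?_, ?_, ?_⟩
    · rintro u rfl hu
      exact BDFWasserstein.exists_solvesG hM hα hτ hr ha hu₀ hg₀ hrel hu
    · rintro g rfl hg
      exact BDFWasserstein.exists_solvesU hM hα hτ hr ha hu₀ hg₀ hrel hg
    · rintro hneg u rfl
      exact BDFWasserstein.solvesU_densities_iff hM hα hτ hr ha hneg hu₀ hg₀ hrel
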